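/- **Setting.** Base stations (BSs) and IoT devices have intensities $\lambda_B,\lambda_D>0$ in the plane; the path-loss exponent is $\alpha>2$; $P_{DL},\omega>0$ are the downlink power and noise, $\delta_1>\delta_2>0$ the SNR thresholds, and $$D_0=\Big(\tfrac{\delta_1\omega}{P_{DL}}\Big)^{-1/\alpha},\quad D_1=\Big(\tfrac{\delta_2\omega}{P_{DL}}\Big)^{-1/\alpha},\quad D_2=\tfrac1{\sqrt{\pi\lambda_B}} .$$ Coverage-enhancement (CE) group $i\in\{1,2\}$ uses the fixed transmit power $P>0$, $K_i$ preamble repetitions of four symbol groups each, and $S_i\ge1$ preambles. Group 2 is treated in two cases: in Case 1 its outer radius is $D_2$ (and $D_1<D_2$); in Case 2 it extends to the boundary of the Voronoi cell. Put $\mathcal A=1-e^{-\mu_{New}}$, let $\mathcal R\in[0,1]$ be the non-restrict probability, and $\lambda_i^a=\lambda_i/S_i$ with $\lambda_1=(e^{-\pi\lambda_BD_0^2}-e^{-\pi\lambda_BD_1^2})\lambda_D$, $\lambda_2=(e^{-\pi\lambda_BD_1^2}-e^{-\pi\lambda_BD_2^2})\lambda_D$ in Case 1, $\lambda_2=e^{-\pi\lambda_BD_1^2}\lambda_D$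 in Case 2. The typical BS is at the origin. The devices of group $i$ that may interfere form a homogeneous Poisson process of intensity $\lambda_i$, with independent marks: each device picks a preamble uniformly among $S_i$, has a Poisson($\mu_{New}$) number of new packets, and is not restricted with probability $\mathcal R$. In the first time slot the interferers are the unrestricted devices with at least one packet, with the same preamble as the randomly chosen device, and at distance more than $\bar D$ from the BS, where $\bar D=D_i$ for group 1 and for group 2 in Case 1, and $\bar D=D_1$ for group 2 in Case 2. The distance $R$ of a served device to the BS is that of a uniform point of the annulus $D_{i-1}\le\|x\|\le D_i$ for group 1 and for group 2 in Case 1; in Case 2 it has the shifted Rayleigh density on $[D_1,\infty)$ given below. All power gains are independent exponential variables of mean one, over devices and symbol groups; positions, marks, distances and gains are mutually independent, and positions, preambles, activity and distances are the same for all symbol groups of the slot. The SINR of a served device with gain $h$ is $PhR^{-\alpha}/(\mathcal I+\sigma^2)$, where $\mathcal I=\sum_jPh_jr_j^{-\alpha}$ runs over the interferers. A repetition succeeds if its four SINRs are all at least $\gamma_{th}>0$, and a preamble is received if some repetition succeeds. The number $N_i$ of intra-group interferers in the cell is independent of all of the above. Its law is the mixture of the Poisson laws of mean $xa$, where $a=\mathcal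 A\mathcal R\lambda_i^a/\lambda_B$ and $x$ (the normalized area of the cell) has the approximate Gamma law of shape $c+1$ and rate $c=3.575$. The RACH success probability in the first time slot is $\mathcal P_i^1=\mathbb E_{N_i}\big[\mathbb P_{S,0}\prod_{m=1}^{N_i}(1-\mathbb P_{S,m})\big]$, where $\mathbb P_{S,m}$ is the probability, given $N_i$, that the preamble of device $m$ is received; device $0$ is the randomly chosen one, and devices $1,\dots,N_i$ are the other ones of its cell and group with its preamble. **Theorem 2.** For CE group $i\in\{1,2\}$ (for $i=2$: in each of the two cases) let $$p_i=\sum_{k=1}^{K_i}(-1)^{k+1}\binom{K_i}{k}\int_{D_{i-1}}^{\hat D}\exp\Big(-\frac{4k\,\gamma_{th}\sigma^2r^\alpha}{P}-2\pi\mathcal A\mathcal R\lambda_i^a\,\mathcal F_i(4k,r)\Big)f_R(r)\,dr,$$ $$\mathcal F_i(l,r)=\int_{\bar D}^\infty\Big(1-\Big(\frac1{1+\gamma_{th}r^\alpha y^{-\alpha}}\Big)^{l}\Big)y\,dy,$$ where, for group 1 and for group 2 in Case 1, $\hat D=\bar D=D_i$ and $f_R(r)=2r/(D_i^2-D_{i-1}^2)$;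 and, for group 2 in Case 2, $\hat D=\infty$, $\bar D=D_1$ and $f_R(r)=2\pi\lambda_Br\exp(-\pi\lambda_B(r^2-D_1^2))$. Then all these integrals converge, $f_R$ is the density of $R$, the integral over $r$ is the probability that the first $k$ repetitions of a device all succeed, $p_i$ is the preamble transmission success probability of a device, $$\mathbb P[N_i=n]=\frac{c^{c+1}\,\Gamma(n+c+1)\,a^{n}}{\Gamma(c+1)\,\Gamma(n+1)\,(a+c)^{n+c+1}}\quad(n\ge0),$$ and the following series converges with the sum $$\mathcal P_i^1=\sum_{n=0}^\infty\mathbb P[N_i=n]\;p_i\,(1-p_i)^{n}.$$ -/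

import Mathlib

open MeasureTheory ProbabilityTheory
open scoped ENNReal NNReal

noncomputable section

namespace NBIoT

/-- The plane, with its Euclidean norm and Lebesgue measure. The typical base station (BS) sits at
the origin. -/
abbrev Plane : Type := EuclideanSpace ℝ (Fin 2)

/-- The (random, possibly infinite) number of points of the sequence `X` in the set `B`. -/
def pointCount {Ω : Type*} (X : ℕ → Ω → Plane) (B : Set Plane) (ω : Ω) : ℕ∞ :=
  {j : ℕ | X j ω ∈ B}.encard

/-- `X` enumerates a homogeneous Poisson point process of intensity `lam` in the plane. -/
structure IsPoissonProcess {Ω : Type*} [MeasurableSpace Ω] (X : ℕ → Ω → Plane) (lam : ℝ)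
    (μ : Measure Ω) : Prop where
  measurable : ∀ j, Measurable (X j)
  count_law : ∀ B : Set Plane, MeasurableSet B → volume B ≠ ∞ → ∀ k : ℕ,
    μ {ω | pointCount X B ω = k} =
      ENNReal.ofReal (Real.exp (-(lam * volume.real B)) * (lam * volume.real B) ^ k
        / (Nat.factorial k : ℝ))
  count_indep : ∀ (n : ℕ) (B : Fin n → Set Plane), (∀ i, MeasurableSet (B i)) →
    (∀ i, volume (B i) ≠ ∞) → Pairwise (fun i j => Disjoint (B i) (B j)) →
    iIndepFun (fun i => pointCount X (B i)) μ

/-- The two coverage-enhancement (CE) groups using the fixed transmit power. Group 2 is treated in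
two cases: Case 1, the outer radius of the group is `D₂`; Case 2, the group extends to the boundary
of the Voronoi cell. -/
inductive Scenario
  | group1
  | group2Case1
  | group2Case2

/-- The numerical parameters, for the CE group under consideration. -/
structure Params where
  /-- intensity of the BSs -/
  lamB : ℝ
  /-- intensity of the IoT devices -/
  lamD : ℝ
  /-- path-loss exponent -/
  α : ℝ
  /-- downlink transmit power -/
  PDL : ℝ
  /-- downlink noise power -/
  ω₀ : ℝ
  /-- downlink SNR threshold between groups 0 and 1 -/
  δ₁ : ℝ
  /-- downlink SNR threshold between groups 1 and 2 -/
  δ₂ : ℝ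
  /-- fixed uplink transmit power -/
  P : ℝ
  /-- the uplink noise power is `σ ^ 2` -/
  σ : ℝ
  /-- SINR threshold -/
  γth : ℝ
  /-- intensity (mean number) of new packets of a device in the first time slot -/
  μNew : ℝ≥0
  /-- non-restrict probability in the first time slot -/
  ℛ : ℝ
  /-- repetition value of the group -/
  K : ℕ
  /-- number of preambles reserved for the group -/
  S : ℕ

namespace Params

variable (p : Params)

def D₀ : ℝ := (p.δ₁ * p.ω₀ / p.PDL) ^ (-(1 / p.α))

def D₁ : ℝ := (p.δ₂ * p.ω₀ / p.PDL) ^ (-(1 / p.α))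

def D₂ : ℝ := 1 / Real.sqrt (Real.pi * p.lamB)

/-- The admissible parameters: all the physical quantities are positive, the thresholds are ordered,
the path-loss exponent exceeds the dimension of the plane, and, where `D₂` is the outer radius of
group 2, the annulus is not degenerate. -/
structure Admissible (s : Scenario) : Prop where
  lamB_pos : 0 < p.lamB
  lamD_pos : 0 < p.lamD
  two_lt_α : 2 < p.α
  PDL_pos : 0 < p.PDL
  ω₀_pos : 0 < p.ω₀
  δ₂_pos : 0 < p.δ₂
  δ₂_lt_δ₁ : p.δ₂ < p.δ₁
  P_pos : 0 < p.P
  γth_pos : 0 < p.γth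
  ℛ_nonneg : 0 ≤ p.ℛ
  ℛ_le_one : p.ℛ ≤ 1
  S_pos : 0 < p.S
  D₁_lt_D₂ : s = Scenario.group2Case1 → p.D₁ < p.D₂

/-- The non-empty probability `𝒜 = ℙ(number of new packets > 0)` in the first time slot. -/
def 𝒜 : ℝ := 1 - Real.exp (-(p.μNew : ℝ))

/-- Intensity `λᵢ` of the approximating Poisson process of the devices of the group. -/
def lamGroup : Scenario → ℝ
  | .group1 => (Real.exp (-(p.lamB * Real.pi * p.D₀ ^ 2))
      - Real.exp (-(p.lamB * Real.pi * p.D₁ ^ 2))) * p.lamD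
  | .group2Case1 => (Real.exp (-(p.lamB * Real.pi * p.D₁ ^ 2))
      - Real.exp (-(p.lamB * Real.pi * p.D₂ ^ 2))) * p.lamD
  | .group2Case2 => Real.exp (-(p.lamB * Real.pi * p.D₁ ^ 2)) * p.lamD

/-- Intensity `λᵢᵃ = λᵢ / Sᵢ` of the devices of the group using a given preamble. -/
def lamA (s : Scenario) : ℝ := p.lamGroup s / p.S

/-- `𝒜 ℛ λᵢᵃ / λ_B`: mean number of active devices with a given preamble per BS. -/
def load (s : Scenario) : ℝ := p.𝒜 * p.ℛ * p.lamA s / p.lamB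

/-- Inner radius `D_{i-1}` of the coverage area. -/
def innerRadius : Scenario → ℝ
  | .group1 => p.D₀
  | .group2Case1 => p.D₁
  | .group2Case2 => p.D₁

/-- The interfering devices are those at a distance larger than this one from the BS: the outer
radius `Dᵢ` of the coverage area for group 1 and for group 2 in Case 1; `D₁` in Case 2. -/
def interfererRadius : Scenario → ℝ
  | .group1 => p.D₁
  | .group2Case1 => p.D₂
  | .group2Case2 => p.D₁

/-- Range of the serving distance. -/
def distRange : Scenario → Set ℝ
  | .group1 => Set.Icc p.D₀ p.D₁
  | .group2Case1 => Set.Icc p.D₁ p.D₂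
  | .group2Case2 => Set.Ici p.D₁

/-- The density `f_R` of the serving distance, on `distRange`. -/
def fR : Scenario → ℝ → ℝ
  | .group1 => fun r => 2 * r / (p.D₁ ^ 2 - p.D₀ ^ 2)
  | .group2Case1 => fun r => 2 * r / (p.D₂ ^ 2 - p.D₁ ^ 2)
  | .group2Case2 => fun r =>
      2 * Real.pi * p.lamB * r * Real.exp (-(p.lamB * Real.pi * (r ^ 2 - p.D₁ ^ 2)))

/-- Law of the distance to the origin of a uniform point of an annulus centred at the origin. -/
def annulusDistLaw (a b : ℝ) : Measure ℝ :=
  (cond (volume : Measure Plane) {x : Plane | a ≤ ‖x‖ ∧ ‖x‖ ≤ b}).map (fun x => ‖x‖)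

/-- Law of the serving distance: that of a uniform point of the annular coverage area for group 1
and for group 2 in Case 1; the shifted Rayleigh law on `[D₁, ∞)` in Case 2. -/
def servingLaw : Scenario → Measure ℝ
  | .group1 => annulusDistLaw p.D₀ p.D₁
  | .group2Case1 => annulusDistLaw p.D₁ p.D₂
  | .group2Case2 => (volume.restrict (Set.Ici p.D₁)).withDensity
      (fun r => ENNReal.ofReal (p.fR .group2Case2 r))

/-- The symbol groups sent in the first time slot: `K` repetitions of a preamble, which consists of
four symbol groups. -/
abbrev Sym : Type := Fin p.K × Fin 4

/-- Channel power gains on all the symbol groups. -/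
abbrev Gains : Type := p.Sym → ℝ

/-- Rayleigh fading: independent channel power gains, exponential of mean one. -/
def fadingLaw : Measure p.Gains := Measure.pi (fun _ => expMeasure 1)

/-- What a potentially interfering device carries besides its position: chosen preamble, number of
new packets, whether it is not restricted by the access scheme, channel power gains. -/
abbrev Mark : Type := Fin p.S × ℕ × Bool × p.Gains

/-- Law of a mark: uniform preamble, Poisson number of packets, not restricted with probability `ℛ`,
Rayleigh fading, all independent. -/
def markLaw : Measure p.Mark :=
  (uniformOn (Set.univ : Set (Fin p.S))).prod ((poissonMeasure p.μNew).prod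
    ((ENNReal.ofReal p.ℛ • Measure.dirac true + ENNReal.ofReal (1 - p.ℛ) • Measure.dirac false).prod
      p.fadingLaw))

/-- The constant of the approximate law of the area of a Poisson-Voronoi cell. -/
def c : ℝ := 3.575

/-- The probability mass function of the number of intra-group interferers. -/
def pmfN (s : Scenario) (n : ℕ) : ℝ :=
  c ^ (c + 1) * Real.Gamma (n + c + 1) * p.load s ^ n /
    (Real.Gamma (c + 1) * Real.Gamma (n + 1) * (p.load s + c) ^ ((n : ℝ) + c + 1))

/-- The integrand of `ℱᵢ`, with `l` symbol groups and serving distance `r`. -/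
def FIntegrand (l : ℕ) (r y : ℝ) : ℝ :=
  (1 - (1 / (1 + p.γth * r ^ p.α * y ^ (-p.α))) ^ l) * y

/-- `ℱᵢ`, with `l` symbol groups and serving distance `r`. -/
def F (s : Scenario) (l : ℕ) (r : ℝ) : ℝ :=
  ∫ y in Set.Ioi (p.interfererRadius s), p.FIntegrand l r y

/-- The integrand, in the serving distance `r`, of the probability that `l` symbol groups are
received successfully. -/
def outerIntegrand (s : Scenario) (l : ℕ) (r : ℝ) : ℝ :=
  Real.exp (-((l : ℝ) * p.γth * p.σ ^ 2 * r ^ p.α / p.P)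
    - 2 * Real.pi * (p.𝒜 * p.ℛ * p.lamA s) * p.F s l r) * p.fR s r

/-- The preamble transmission success probability, as a finite sum. -/
def preambleSum (s : Scenario) : ℝ :=
  ∑ k ∈ Finset.Icc 1 p.K, (-1 : ℝ) ^ (k + 1) * (p.K.choose k : ℝ) *
    ∫ r in p.distRange s, p.outerIntegrand s (4 * k) r

end Params

/-- The first time slot, seen from the typical BS. Device `0` is the randomly chosen device, which
uses the preamble `s₀`; the devices `1, …, N` are the other active devices of its group and cell
using the same preamble. -/
structure Model (p : Params) (s : Scenario) (s₀ : Fin p.S) {Ω : Type*} [MeasurableSpace Ω]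
    (μ : Measure Ω) where
  /-- positions of the devices of the Poisson process approximating the interferers of the group -/
  X : ℕ → Ω → Plane
  /-- their marks -/
  M : ℕ → Ω → p.Mark
  /-- the distances to the BS of the devices `0, 1, 2, …` served by it -/
  R : ℕ → Ω → ℝ
  /-- their channel power gains -/
  h : ℕ → Ω → p.Gains
  /-- number of intra-group interferers using the preamble `s₀` in the cell -/
  N : Ω → ℕ
  isPoisson_X : IsPoissonProcess X (p.lamGroup s) μ
  measurable_M : ∀ j, Measurable (M j)
  law_M : ∀ j, μ.map (M j) = p.markLaw
  indep_M : iIndepFun M μ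
  measurable_R : ∀ m, Measurable (R m)
  measurable_h : ∀ m, Measurable (h m)
  law_Rh : ∀ m, μ.map (fun ω => (R m ω, h m ω)) = (p.servingLaw s).prod p.fadingLaw
  indep_Rh : iIndepFun (fun m ω => (R m ω, h m ω)) μ
  measurable_N : Measurable N
  /-- given the area `x / λ_B` of the cell of the randomly chosen device, `N` is Poisson of mean
  `load * x`; the normalized area `x` has the (approximate) Gamma law of shape `c + 1`, rate `c` -/
  law_N : ∀ n : ℕ, μ.real {ω | N ω = n} =
    ∫ x, Real.exp (-(p.load s * x)) * (p.load s * x) ^ n / (Nat.factorial n : ℝ)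
      ∂(gammaMeasure (Params.c + 1) Params.c)
  /-- with the two fields that follow: positions, marks, served devices and `N` are mutually independent -/
  indep_X : IndepFun (fun ω j => X j ω)
    (fun ω => ((fun j => M j ω), (fun m => (R m ω, h m ω)), N ω)) μ
  indep_MRhN : IndepFun (fun ω j => M j ω) (fun ω => ((fun m => (R m ω, h m ω)), N ω)) μ
  indep_RhN : IndepFun (fun ω m => (R m ω, h m ω)) N μ

namespace Model

variable {p : Params} {s : Scenario} {s₀ : Fin p.S} {Ω : Type*} [MeasurableSpace Ω]
  {μ : Measure Ω} (A : Model p s s₀ μ)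

/-- The interfering devices: preamble `s₀`, non-empty buffer, not restricted, and located outside
the disc of radius `interfererRadius`. -/
def interferers (ω : Ω) : Set ℕ :=
  {j | (A.M j ω).1 = s₀ ∧ 0 < (A.M j ω).2.1 ∧ (A.M j ω).2.2.1 = true ∧
    p.interfererRadius s < ‖A.X j ω‖}

/-- The aggregate interference at the BS during the symbol group `b`, in `[0, ∞]`. -/
def interference (b : p.Sym) (ω : Ω) : ℝ≥0∞ :=
  ∑' j : A.interferers ω,
    ENNReal.ofReal (p.P * (A.M j ω).2.2.2 b * ‖A.X j ω‖ ^ (-p.α))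

/-- The SINR, in `[0, ∞]`, of device `m` during the symbol group `b`. -/
def SINR (m : ℕ) (b : p.Sym) (ω : Ω) : ℝ≥0∞ :=
  ENNReal.ofReal (p.P * A.h m ω b * A.R m ω ^ (-p.α)) /
    (A.interference b ω + ENNReal.ofReal (p.σ ^ 2))

/-- The event `θ_k`: in repetition `k` all four SINRs of device `m` reach the threshold. -/
def θ (m : ℕ) (k : Fin p.K) : Set Ω :=
  {ω | ∀ t : Fin 4, ENNReal.ofReal p.γth ≤ A.SINR m (k, t) ω}

/-- The event that the preamble of device `m` is received: some repetition succeeds. -/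
def success (m : ℕ) : Set Ω := ⋃ k : Fin p.K, A.θ m k

/-- The preamble transmission success probability of device `m`, given `N = n`. -/
def PS (m n : ℕ) : ℝ := (cond μ {ω | A.N ω = n}).real (A.success m)

/-- The RACH success probability in the first time slot: the expectation over `N` of the probability
that the preamble of the randomly chosen device is received times the probabilities that those of
the `N` other devices are not. -/
def rachSuccess : ℝ :=
  ∫ ω, A.PS 0 (A.N ω) * ∏ m ∈ Finset.Icc 1 (A.N ω), (1 - A.PS m (A.N ω)) ∂μ

end Model

end NBIoT

end

/-! Fix a device at distance `r` and a set `T` of `l` symbol groups. A mean-one exponential gain is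
at least `t` with probability `exp (-t)`, and the gains are independent. So, given the interferers,
the probability that all SINRs in `T` reach the threshold is the exponential of minus a linear
function of noise and interference (`fadingLaw_received`). Averaging over the interferers is then an
evaluation of the Laplace functional of a marked Poisson process
(`IsPoissonProcess.lintegral_expNeg_marked`). An interferer is active with probability `𝒜 ℛ / S`,
and its gain on each symbol group then yields one factor `1 / (1 + u)`. Position and activity are
common to all symbol groups, so these factors form an `l`-th power inside a single spatial integral
(`lintegral_expNeg_contrib`), which polar coordinates turn into `2π ℱ`. Averaging over `r` gives
`Model.measure_received`.

For `l = 4k` this is the probability that `k` given repetitions succeed. It depends on `k` only, so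
inclusion-exclusion yields the preamble probability `q` (`Model.measureReal_success`). Reception is
a function of data independent of `N`, hence conditioning on `N` does not change it, and the RACH
probability is the mean of `q (1 - q) ^ N`, expanded over the values of `N`. The law of `N` is a
Gamma integral.

The Laplace functional is built from the counts on disjoint sets, through simple functions and
limits. Working with `exp (-t)` on `[0, ∞]` removes any need to prove that the interference is
almost surely finite. -/

noncomputable section

namespace NBIoT

/-! ### The function `exp (-t)` on `[0, ∞]` -/

/-- The function `t ↦ exp (-t)` on `[0, ∞]`, with value `0` at `∞`. -/
def expNeg (t : ℝ≥0∞) : ℝ≥0∞ := EReal.exp (-(t : EReal))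

@[simp] lemma expNeg_zero : expNeg 0 = 1 := by simp [expNeg]

@[simp] lemma expNeg_top : expNeg ∞ = 0 := by simp [expNeg]

lemma expNeg_add (a b : ℝ≥0∞) : expNeg (a + b) = expNeg a * expNeg b := by
  rw [expNeg, expNeg, expNeg, ← EReal.exp_add, EReal.coe_ennreal_add, EReal.neg_add]
  · rfl
  · left; simp
  · right; simp

lemma expNeg_ofReal {x : ℝ} (hx : 0 ≤ x) :
    expNeg (ENNReal.ofReal x) = ENNReal.ofReal (Real.exp (-x)) := by
  rw [expNeg, EReal.coe_ennreal_ofReal, max_eq_left hx, ← EReal.coe_neg, EReal.exp_coe]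

lemma expNeg_le_one (t : ℝ≥0∞) : expNeg t ≤ 1 := by
  rw [expNeg, EReal.exp_le_one_iff, EReal.neg_le, neg_zero]
  exact EReal.coe_ennreal_nonneg t

lemma expNeg_ne_top (t : ℝ≥0∞) : expNeg t ≠ ∞ :=
  ((expNeg_le_one t).trans_lt ENNReal.one_lt_top).ne

lemma continuous_expNeg : Continuous expNeg :=
  ENNReal.continuous_exp.comp (continuous_neg.comp continuous_coe_ennreal_ereal)

@[fun_prop]
lemma measurable_expNeg : Measurable expNeg := continuous_expNeg.measurable

lemma expNeg_sum {ι : Type*} (s : Finset ι) (f : ι → ℝ≥0∞) :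
    expNeg (∑ i ∈ s, f i) = ∏ i ∈ s, expNeg (f i) := by
  classical
  induction s using Finset.induction_on with
  | empty => simp
  | insert a s ha ih => rw [Finset.sum_insert ha, Finset.prod_insert ha, expNeg_add, ih]

lemma expNeg_mul_natCast (c : ℝ≥0∞) (n : ℕ) : expNeg (c * n) = expNeg c ^ n := by
  have := expNeg_sum (Finset.range n) (fun _ => c)
  simpa [mul_comm] using this

/-- The inverse `g ↦ -log g` of `expNeg` on `[0, 1]`. -/
def negLog (g : ℝ≥0∞) : ℝ≥0∞ := (-(ENNReal.log g)).toENNReal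

lemma expNeg_negLog {g : ℝ≥0∞} (hg : g ≤ 1) : expNeg (negLog g) = g := by
  have : 0 ≤ -(ENNReal.log g) := by
    rw [EReal.le_neg, neg_zero]
    exact ENNReal.log_le_zero_iff.2 hg
  rw [expNeg, negLog, EReal.coe_toENNReal this, neg_neg, ENNReal.exp_log]

lemma measurable_negLog : Measurable negLog :=
  (measurable_neg.comp ENNReal.measurable_log).ereal_toENNReal

/-- Continuity of `expNeg` at `∞` makes summability unnecessary: a divergent sum corresponds to
products tending to `0`. -/
lemma tendsto_prod_expNeg (f : ℕ → ℝ≥0∞) :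
    Filter.Tendsto (fun n => ∏ j ∈ Finset.range n, expNeg (f j)) Filter.atTop
      (nhds (expNeg (∑' j, f j))) := by
  simp_rw [← expNeg_sum]
  exact (continuous_expNeg.tendsto _).comp (ENNReal.tendsto_nat_tsum f)

/-! ### The Laplace functional of a Poisson process -/

lemma toENNReal_pointCount {Ω : Type*} (X : ℕ → Ω → Plane) (B : Set Plane) (ω : Ω) :
    (pointCount X B ω : ℝ≥0∞) = ∑' j, B.indicator (fun _ => (1 : ℝ≥0∞)) (X j ω) := by
  rw [pointCount, ← ENNReal.tsum_set_one,
    tsum_subtype {j : ℕ | X j ω ∈ B} (fun _ => (1 : ℝ≥0∞))]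
  rfl

section Laplace

variable {Ω : Type*} [MeasurableSpace Ω] {X : ℕ → Ω → Plane} {lam : ℝ} {μ : Measure Ω}

lemma measurable_pointCount (hX : ∀ j, Measurable (X j)) {B : Set Plane} (hB : MeasurableSet B) :
    Measurable (pointCount X B) := by
  refine measurable_to_countable' fun k => ?_
  have h : pointCount X B ⁻¹' {k} = (fun ω => (pointCount X B ω : ℝ≥0∞)) ⁻¹' {(k : ℝ≥0∞)} := by
    ext ω
    simp
  rw [h]
  simp_rw [toENNReal_pointCount]
  exact (Measurable.tsum fun j => (measurable_const.indicator hB).comp (hX j))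
    (measurableSet_singleton _)

/-- This is the generating function of a Poisson variable at `exp (-c)`; `c = ∞` gives the void
probability. -/
lemma IsPoissonProcess.lintegral_expNeg_pointCount [IsProbabilityMeasure μ]
    (h : IsPoissonProcess X lam μ) (hlam : 0 ≤ lam) {B : Set Plane} (hB : MeasurableSet B)
    (hBfin : volume B ≠ ∞) (c : ℝ≥0∞) :
    ∫⁻ ω, expNeg (c * pointCount X B ω) ∂μ
      = expNeg (ENNReal.ofReal lam * (volume B * (1 - expNeg c))) := by
  set m : ℝ := lam * volume.real B with hm
  have hm0 : 0 ≤ m := mul_nonneg hlam measureReal_nonneg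
  obtain ⟨e, he0, he⟩ : ∃ e : ℝ, 0 ≤ e ∧ expNeg c = ENNReal.ofReal e :=
    ⟨(expNeg c).toReal, ENNReal.toReal_nonneg, (ENNReal.ofReal_toReal (expNeg_ne_top c)).symm⟩
  have he1 : e ≤ 1 := by
    simpa [he] using expNeg_le_one c
  have hmeas : Measurable (pointCount X B) := measurable_pointCount h.measurable hB
  have hexp : ∀ x : ℝ, HasSum (fun n : ℕ => x ^ n / (Nat.factorial n : ℝ)) (Real.exp x) := by
    intro x
    rw [Real.exp_eq_exp_ℝ]
    exact NormedSpace.expSeries_div_hasSum_exp x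
  have hset : ∀ k : ℕ∞, MeasurableSet {ω | pointCount X B ω = k} := fun k =>
    hmeas (measurableSet_singleton k)
  -- Used twice: at `x = 1` for the total mass, at `x = exp (-c)` for the generating function.
  have hsum : ∀ x : ℝ, 0 ≤ x →
      ∑' k : ℕ, ENNReal.ofReal (Real.exp (-m) * m ^ k / (Nat.factorial k : ℝ))
        * ENNReal.ofReal x ^ k = ENNReal.ofReal (Real.exp (-(m * (1 - x)))) := by
    intro x hx
    have h1 := (hexp (m * x)).mul_left (Real.exp (-m))
    rw [← Real.exp_add] at h1
    rw [show -(m * (1 - x)) = -m + m * x by ring, ← h1.tsum_eq,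
      ENNReal.ofReal_tsum_of_nonneg (fun n => by positivity) h1.summable]
    refine tsum_congr fun k => ?_
    rw [← ENNReal.ofReal_pow hx, ← ENNReal.ofReal_mul (by positivity), mul_pow m x]
    ring_nf
  -- The law is prescribed only at finite values; their masses add up to one, so the count is almost
  -- surely finite.
  have htop : ∀ᵐ ω ∂μ, pointCount X B ω ≠ ⊤ := by
    have h1 : μ (⋃ k : ℕ, {ω | pointCount X B ω = k}) = 1 := by
      rw [measure_iUnion]
      · have := hsum 1 zero_le_one
        simp only [ENNReal.ofReal_one, one_pow, mul_one, sub_self, mul_zero, neg_zero,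
          Real.exp_zero] at this
        rw [← this]
        exact tsum_congr fun k => h.count_law B hB hBfin k
      · intro i j hij
        refine Set.disjoint_left.2 fun ω hi hj => hij ?_
        have : (i : ℕ∞) = j := hi.symm.trans hj
        exact_mod_cast this
      · exact fun k => hset k
    have h2 : ∀ᵐ ω ∂μ, ω ∈ ⋃ k : ℕ, {ω | pointCount X B ω = k} :=
      (mem_ae_iff_prob_eq_one (MeasurableSet.iUnion fun k : ℕ => hset k)).2 h1
    filter_upwards [h2] with ω hω
    obtain ⟨k, hk⟩ := Set.mem_iUnion.1 hω
    rw [show pointCount X B ω = k from hk]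
    exact ENat.natCast_ne_top k
  have hae : (fun ω => expNeg (c * pointCount X B ω)) =ᵐ[μ] fun ω =>
      ∑' k : ℕ, {ω | pointCount X B ω = k}.indicator (fun _ => expNeg c ^ k) ω := by
    filter_upwards [htop] with ω hω
    obtain ⟨n, hn⟩ := ENat.ne_top_iff_exists.1 hω
    rw [tsum_eq_single n]
    · rw [Set.indicator_of_mem (by exact hn.symm), ← hn, ENat.toENNReal_coe, expNeg_mul_natCast]
    · intro k hk
      refine Set.indicator_of_notMem (fun hk' => hk ?_) _
      have : (n : ℕ∞) = k := hn.trans hk'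
      exact_mod_cast this.symm
  rw [lintegral_congr_ae hae, lintegral_tsum fun k : ℕ =>
    (measurable_const.indicator (hset k)).aemeasurable]
  simp_rw [lintegral_indicator_const (hset _), h.count_law B hB hBfin, he]
  have h3 := hsum e he0
  have h4 : ENNReal.ofReal lam * (volume B * (1 - ENNReal.ofReal e))
      = ENNReal.ofReal (m * (1 - e)) := by
    rw [ENNReal.ofReal_mul hm0, hm, ENNReal.ofReal_mul hlam, Measure.real,
      ENNReal.ofReal_toReal hBfin, ENNReal.ofReal_sub _ he0, ENNReal.ofReal_one, mul_assoc]
  rw [h4, expNeg_ofReal (mul_nonneg hm0 (by linarith)), ← h3]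
  exact tsum_congr fun k => mul_comm _ _

lemma IsPoissonProcess.lintegral_expNeg_simple [IsProbabilityMeasure μ]
    (h : IsPoissonProcess X lam μ) (hlam : 0 ≤ lam) {n : ℕ} (B : Fin n → Set Plane)
    (hB : ∀ i, MeasurableSet (B i)) (hBfin : ∀ i, volume (B i) ≠ ∞)
    (hdisj : Pairwise fun i j => Disjoint (B i) (B j)) (c : Fin n → ℝ≥0∞) :
    ∫⁻ ω, expNeg (∑ i, c i * pointCount X (B i) ω) ∂μ
      = expNeg (ENNReal.ofReal lam * ∑ i, volume (B i) * (1 - expNeg (c i))) := by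
  have hind : iIndepFun (fun i ω => expNeg (c i * pointCount X (B i) ω)) μ :=
    (h.count_indep n B hB hBfin hdisj).comp (fun i (k : ℕ∞) => expNeg (c i * (k : ℝ≥0∞)))
      (fun i => measurable_of_countable _)
  simp_rw [expNeg_sum]
  rw [lintegral_prod_eq_prod_lintegral_of_indepFun _ _ hind, Finset.mul_sum, expNeg_sum]
  · exact Finset.prod_congr rfl fun i _ =>
      h.lintegral_expNeg_pointCount hlam (hB i) (hBfin i) (c i)
  · exact fun i => (measurable_of_countable (fun k : ℕ∞ => expNeg (c i * (k : ℝ≥0∞)))).comp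
      (measurable_pointCount h.measurable (hB i))

lemma IsPoissonProcess.lintegral_expNeg_simpleFunc [IsProbabilityMeasure μ]
    (h : IsPoissonProcess X lam μ) (hlam : 0 ≤ lam) (f : SimpleFunc Plane ℝ≥0∞)
    (hf : volume (Function.support f) ≠ ∞) :
    ∫⁻ ω, expNeg (∑' j, f (X j ω)) ∂μ
      = expNeg (ENNReal.ofReal lam * ∫⁻ x, (1 - expNeg (f x))) := by
  classical
  -- The value `0` is left out: its level set has infinite area, and it contributes nothing to
  -- either side.
  set S : Finset ℝ≥0∞ := f.range.filter (· ≠ 0) with hS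
  set v : Fin S.card → ℝ≥0∞ := fun i => (S.equivFin.symm i : ℝ≥0∞) with hv
  have hvne : ∀ i, v i ≠ 0 := fun i => (Finset.mem_filter.1 (S.equivFin.symm i).2).2
  have hvinj : Function.Injective v := fun i j hij =>
    S.equivFin.symm.injective (Subtype.ext hij)
  -- Stated for general `F` to serve both sides: the identity for the sum over points, `1 - expNeg`
  -- for the spatial integral.
  have hsum : ∀ (F : ℝ≥0∞ → ℝ≥0∞), F 0 = 0 → ∀ x,
      F (f x) = ∑ i, F (v i) * (f ⁻¹' {v i}).indicator (fun _ => (1 : ℝ≥0∞)) x := by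
    intro F hF x
    by_cases hx : f x = 0
    · rw [hx, hF]
      refine (Finset.sum_eq_zero fun i _ => ?_).symm
      rw [Set.indicator_of_notMem, mul_zero]
      intro hi
      exact hvne i (hx ▸ (Set.mem_singleton_iff.1 hi).symm)
    · have hxS : f x ∈ S := Finset.mem_filter.2 ⟨f.mem_range_self x, hx⟩
      have hvi : v (S.equivFin ⟨f x, hxS⟩) = f x := by simp [hv]
      rw [Finset.sum_eq_single (S.equivFin ⟨f x, hxS⟩)]
      · rw [Set.indicator_of_mem (by simp [hvi]), mul_one, hvi]
      · intro i _ hi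
        rw [Set.indicator_of_notMem, mul_zero]
        intro hi'
        exact hi (hvinj (((Set.mem_singleton_iff.1 hi').symm).trans hvi.symm))
      · simp
  have hmeas : ∀ i, MeasurableSet (f ⁻¹' {v i}) := fun i => f.measurableSet_fiber _
  have h1 : ∀ ω, ∑' j, f (X j ω) = ∑ i, v i * pointCount X (f ⁻¹' {v i}) ω := by
    intro ω
    simp_rw [toENNReal_pointCount, ← ENNReal.tsum_mul_left]
    rw [← Summable.tsum_finsetSum fun i _ => ENNReal.summable]
    exact tsum_congr fun j => hsum id rfl (X j ω)
  have h2 : ∫⁻ x, (1 - expNeg (f x)) = ∑ i, volume (f ⁻¹' {v i}) * (1 - expNeg (v i)) := by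
    rw [lintegral_congr (hsum (fun t => 1 - expNeg t) (by simp)), lintegral_finsetSum]
    · refine Finset.sum_congr rfl fun i _ => ?_
      rw [lintegral_const_mul _ (measurable_const.indicator (hmeas i)),
        lintegral_indicator_const (hmeas i), one_mul, mul_comm]
    · exact fun i _ => (measurable_const.indicator (hmeas i)).const_mul _
  simp_rw [h1, h2]
  refine h.lintegral_expNeg_simple hlam _ hmeas (fun i => ?_) (fun i j hij => ?_) v
  · refine ne_top_of_le_ne_top hf (measure_mono fun x hx => ?_)
    rw [Function.mem_support, Set.mem_singleton_iff.1 hx]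
    exact hvne i
  · refine Set.disjoint_left.2 fun x hi hj => hij (hvinj ?_)
    exact (Set.mem_singleton_iff.1 hi).symm.trans (Set.mem_singleton_iff.1 hj)

/-- The Laplace functional of a homogeneous Poisson process. -/
theorem IsPoissonProcess.lintegral_expNeg_tsum [IsProbabilityMeasure μ]
    (h : IsPoissonProcess X lam μ) (hlam : 0 ≤ lam) {f : Plane → ℝ≥0∞} (hf : Measurable f) :
    ∫⁻ ω, expNeg (∑' j, f (X j ω)) ∂μ
      = expNeg (ENNReal.ofReal lam * ∫⁻ x, (1 - expNeg (f x))) := by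
  -- Cutting off to a growing ball gives supports of finite area while keeping the approximation
  -- increasing.
  set g : ℕ → SimpleFunc Plane ℝ≥0∞ := fun n =>
    (SimpleFunc.eapprox f n).restrict (Metric.ball 0 n) with hg
  have hgapp : ∀ n x, g n x = (Metric.ball (0 : Plane) n).indicator (SimpleFunc.eapprox f n) x :=
    fun n x => by rw [hg]; exact SimpleFunc.restrict_apply _ measurableSet_ball x
  have hmono : ∀ x, Monotone fun n => g n x := by
    intro x m n hmn
    simp only [hgapp]
    by_cases hx : x ∈ Metric.ball (0 : Plane) m
    · rw [Set.indicator_of_mem hx, Set.indicator_of_mem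
        (Metric.ball_subset_ball (by exact_mod_cast hmn) hx)]
      exact SimpleFunc.monotone_eapprox f hmn x
    · rw [Set.indicator_of_notMem hx]
      exact zero_le
  have hlim : ∀ x, Filter.Tendsto (fun n => g n x) Filter.atTop (nhds (f x)) := by
    intro x
    have h1 : Filter.Tendsto (fun n => SimpleFunc.eapprox f n x) Filter.atTop (nhds (f x)) := by
      have := tendsto_atTop_iSup (f := fun n => SimpleFunc.eapprox f n x)
        (fun m n hmn => SimpleFunc.monotone_eapprox f hmn x)
      rwa [SimpleFunc.iSup_eapprox_apply hf] at this
    refine h1.congr' ?_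
    obtain ⟨N, hN⟩ := exists_nat_gt ‖x‖
    filter_upwards [Filter.eventually_ge_atTop N] with n hn
    rw [hgapp, Set.indicator_of_mem]
    rw [mem_ball_zero_iff]
    exact hN.trans_le (by exact_mod_cast hn)
  have hfin : ∀ n, volume (Function.support (g n)) ≠ ∞ := by
    intro n
    refine ne_top_of_le_ne_top (measure_ball_lt_top (x := (0 : Plane)) (r := n)).ne
      (measure_mono fun x hx => ?_)
    by_contra hx'
    exact hx (by rw [hgapp, Set.indicator_of_notMem hx'])
  have hX := h.measurable
  have hL : Filter.Tendsto (fun n => ∫⁻ ω, expNeg (∑' j, g n (X j ω)) ∂μ) Filter.atTop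
      (nhds (∫⁻ ω, expNeg (∑' j, f (X j ω)) ∂μ)) := by
    refine tendsto_lintegral_of_dominated_convergence (fun _ => 1) (fun n => ?_)
      (fun n => Filter.Eventually.of_forall fun ω => expNeg_le_one _) (by simp)
      (Filter.Eventually.of_forall fun ω => ?_)
    · exact measurable_expNeg.comp
        (Measurable.tsum fun j => (g n).measurable.comp (hX j))
    · refine (continuous_expNeg.tendsto _).comp ?_
      -- Seen as an integral for the counting measure, the sum over points converges by monotone
      -- convergence.
      simp_rw [← lintegral_count]
      exact lintegral_tendsto_of_tendsto_of_monotone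
        (fun n => (measurable_of_countable _).aemeasurable)
        (Filter.Eventually.of_forall fun j => hmono (X j ω))
        (Filter.Eventually.of_forall fun j => hlim (X j ω))
  have hanti : ∀ s t : ℝ≥0∞, s ≤ t → expNeg t ≤ expNeg s := fun s t hst => by
    rw [expNeg, expNeg, EReal.exp_le_exp_iff, EReal.neg_le_neg_iff]
    exact_mod_cast hst
  have hR : Filter.Tendsto (fun n => ∫⁻ x, (1 - expNeg (g n x))) Filter.atTop
      (nhds (∫⁻ x, (1 - expNeg (f x)))) := by
    refine lintegral_tendsto_of_tendsto_of_monotone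
      (fun n => (measurable_const.sub (measurable_expNeg.comp (g n).measurable)).aemeasurable)
      (Filter.Eventually.of_forall fun x m n hmn =>
        tsub_le_tsub_left (hanti _ _ (hmono x hmn)) _)
      (Filter.Eventually.of_forall fun x => ?_)
    exact ENNReal.Tendsto.sub tendsto_const_nhds ((continuous_expNeg.tendsto _).comp (hlim x))
      (Or.inl ENNReal.one_ne_top)
  have hR' := (continuous_expNeg.tendsto _).comp
    (ENNReal.Tendsto.const_mul (a := ENNReal.ofReal lam) hR (Or.inr ENNReal.ofReal_ne_top))
  refine tendsto_nhds_unique hL (hR'.congr fun n => ?_)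
  exact (h.lintegral_expNeg_simpleFunc hlam (g n) (hfin n)).symm

end Laplace

/-! ### Exponential power gains -/

instance : IsProbabilityMeasure (expMeasure 1) := isProbabilityMeasure_expMeasure one_pos

lemma lintegral_expMeasure_one {f : ℝ → ℝ≥0∞} (hf : Measurable f) :
    ∫⁻ h, f h ∂(expMeasure 1) = ∫⁻ h in Set.Ioi 0, ENNReal.ofReal (Real.exp (-h)) * f h := by
  have hpdf : Measurable (gammaPDF 1 1) := (measurable_gammaPDFReal 1 1).ennreal_ofReal
  rw [expMeasure, gammaMeasure, lintegral_withDensity_eq_lintegral_mul _ hpdf hf,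
    setLIntegral_congr Ioi_ae_eq_Ici, ← lintegral_indicator measurableSet_Ici]
  refine lintegral_congr fun h => ?_
  by_cases hh : 0 ≤ h
  · rw [Set.indicator_of_mem (by exact hh), Pi.mul_apply, gammaPDF_of_nonneg hh]
    simp
  · rw [Set.indicator_of_notMem (by exact hh), Pi.mul_apply, gammaPDF_of_neg (not_le.1 hh),
      zero_mul]

lemma ae_pos_expMeasure_one : ∀ᵐ h ∂(expMeasure 1), 0 < h := by
  have hs : MeasurableSet {h : ℝ | ¬ 0 < h} := measurableSet_Ioi.compl
  rw [ae_iff, ← lintegral_indicator_one hs, lintegral_expMeasure_one (measurable_one.indicator hs)]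
  rw [setLIntegral_congr_fun (g := fun _ => 0) measurableSet_Ioi fun h hh => ?_]
  · simp
  · have : h ∉ {h : ℝ | ¬ 0 < h} := fun h' => h' hh
    simp only [Set.indicator_of_notMem this, mul_zero]

/-- The exponential tail turns a threshold condition on a gain into a Laplace transform. The value
`t = ∞` is needed for infinite interference. -/
lemma expMeasure_one_ge (t : ℝ≥0∞) : expMeasure 1 {h | t ≤ ENNReal.ofReal h} = expNeg t := by
  induction t using ENNReal.recTopCoe with
  | top => simp
  | coe x =>
    have hs : MeasurableSet {h | (x : ℝ≥0∞) ≤ ENNReal.ofReal h} :=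
      measurableSet_le measurable_const ENNReal.measurable_ofReal
    have hsub : ∀ᵐ h ∂(volume.restrict (Set.Ioi (0 : ℝ))),
        ENNReal.ofReal (Real.exp (-h)) * {h | (x : ℝ≥0∞) ≤ ENNReal.ofReal h}.indicator 1 h
          = (Set.Ici (x : ℝ)).indicator (fun h => ENNReal.ofReal (Real.exp (-h))) h := by
      filter_upwards [ae_restrict_mem measurableSet_Ioi] with h hh
      have h1 : h ∈ {h | (x : ℝ≥0∞) ≤ ENNReal.ofReal h} ↔ h ∈ Set.Ici (x : ℝ) := by
        rw [Set.mem_ofPred_eq, Set.mem_Ici, ← ENNReal.ofReal_coe_nnreal,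
          ENNReal.ofReal_le_ofReal_iff (le_of_lt hh)]
      by_cases h2 : h ∈ Set.Ici (x : ℝ)
      · rw [Set.indicator_of_mem h2, Set.indicator_of_mem (h1.2 h2), Pi.one_apply, mul_one]
      · rw [Set.indicator_of_notMem h2, Set.indicator_of_notMem (fun h3 => h2 (h1.1 h3)), mul_zero]
    rw [← lintegral_indicator_one hs, lintegral_expMeasure_one (measurable_one.indicator hs),
      lintegral_congr_ae hsub, setLIntegral_congr Ioi_ae_eq_Ici,
      setLIntegral_indicator measurableSet_Ici,
      Set.inter_eq_left.2 (Set.Ici_subset_Ici.2 x.coe_nonneg), ← setLIntegral_congr Ioi_ae_eq_Ici,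
      ← ofReal_integral_eq_lintegral_ofReal (integrableOn_exp_neg_Ioi _)
        (Filter.Eventually.of_forall fun h => (Real.exp_pos _).le), integral_exp_neg_Ioi,
      ← expNeg_ofReal x.coe_nonneg, ENNReal.ofReal_coe_nnreal]

lemma lintegral_expNeg_expMeasure_one {a : ℝ} (ha : 0 ≤ a) :
    ∫⁻ h, expNeg (ENNReal.ofReal (a * h)) ∂(expMeasure 1) = ENNReal.ofReal (1 / (1 + a)) := by
  have h1 : -(1 + a) < 0 := by linarith
  rw [lintegral_expMeasure_one (by fun_prop),
    setLIntegral_congr_fun (g := fun h => ENNReal.ofReal (Real.exp (-(1 + a) * h)))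
      measurableSet_Ioi fun h hh => ?_,
    ← ofReal_integral_eq_lintegral_ofReal (integrableOn_exp_mul_Ioi h1 0)
      (Filter.Eventually.of_forall fun h => (Real.exp_pos _).le), integral_exp_mul_Ioi h1]
  · congr 1
    rw [mul_zero, Real.exp_zero, neg_div_neg_eq]
  · have hh' : 0 ≤ h := le_of_lt hh
    simp only
    rw [expNeg_ofReal (mul_nonneg ha hh'), ← ENNReal.ofReal_mul (Real.exp_pos _).le, ← Real.exp_add]
    ring_nf

variable (p : Params)

instance : IsProbabilityMeasure p.fadingLaw := by
  unfold Params.fadingLaw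
  infer_instance

/-- By independence the tails multiply, so the thresholds add up in the exponent. -/
lemma fadingLaw_forall_ge (T : Finset p.Sym) (t : p.Sym → ℝ≥0∞) :
    p.fadingLaw {h | ∀ b ∈ T, t b ≤ ENNReal.ofReal (h b)} = expNeg (∑ b ∈ T, t b) := by
  rw [expNeg_sum, ← Finset.prod_congr rfl fun b _ => expMeasure_one_ge (t b),
    ← Measure.pi_pi_finset (fun _ : p.Sym => expMeasure 1)
      (fun b => {h | t b ≤ ENNReal.ofReal h}) T]
  rfl

lemma lintegral_expNeg_fadingLaw (T : Finset p.Sym) {a : ℝ} (ha : 0 ≤ a) :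
    ∫⁻ h, expNeg (∑ b ∈ T, ENNReal.ofReal (a * h b)) ∂p.fadingLaw
      = ENNReal.ofReal (1 / (1 + a)) ^ T.card := by
  have hind : iIndepFun (fun b (h : p.Gains) => expNeg (ENNReal.ofReal (a * h b))) p.fadingLaw :=
    iIndepFun_pi (μ := fun _ : p.Sym => expMeasure 1)
      (X := fun _ h => expNeg (ENNReal.ofReal (a * h))) fun b => by fun_prop
  simp_rw [expNeg_sum]
  rw [lintegral_prod_eq_prod_lintegral_of_indepFun _ _ hind (fun b => by fun_prop)]
  rw [Finset.prod_congr rfl fun b _ => ?_, Finset.prod_const]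
  rw [← lintegral_expNeg_expMeasure_one ha]
  exact (measurePreserving_eval (fun _ : p.Sym => expMeasure 1) b).lintegral_comp
    (f := fun h => expNeg (ENNReal.ofReal (a * h))) (by fun_prop)

lemma ae_pos_fadingLaw : ∀ᵐ h ∂p.fadingLaw, ∀ b, 0 < h b := by
  rw [ae_all_iff]
  exact fun b => (measurePreserving_eval (fun _ : p.Sym => expMeasure 1)
    b).quasiMeasurePreserving.ae ae_pos_expMeasure_one

/-! ### The marks -/

/-- The marks of the devices that transmit the preamble `s₀`. -/
def activeMarks (s₀ : Fin p.S) : Set p.Mark := {m | m.1 = s₀ ∧ 0 < m.2.1 ∧ m.2.2.1 = true}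

lemma measurableSet_activeMarks (s₀ : Fin p.S) : MeasurableSet (activeMarks p s₀) := by
  refine ((measurableSet_singleton s₀).preimage measurable_fst).inter
    (((measurableSet_Ioi (a := (0 : ℕ))).preimage (measurable_fst.comp measurable_snd)).inter ?_)
  exact (measurableSet_singleton true).preimage
    (measurable_fst.comp (measurable_snd.comp measurable_snd))

/-- The thinning probability `𝒜 ℛ / S`. -/
def activeProb : ℝ := p.𝒜 * p.ℛ / p.S

/-- The law of the access mark of a device. -/
def accessLaw : Measure Bool :=
  ENNReal.ofReal p.ℛ • Measure.dirac true + ENNReal.ofReal (1 - p.ℛ) • Measure.dirac false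

instance : IsFiniteMeasure (accessLaw p) := by
  refine ⟨?_⟩
  simp [accessLaw]

lemma 𝒜_nonneg : 0 ≤ p.𝒜 := by
  simp [Params.𝒜]

variable {p} {s : Scenario}

lemma isProbabilityMeasure_accessLaw (hp : p.Admissible s) :
    IsProbabilityMeasure (accessLaw p) := by
  refine ⟨?_⟩
  simp only [accessLaw, Measure.coe_add, Measure.coe_smul, Pi.add_apply, Pi.smul_apply,
    measure_univ, smul_eq_mul, mul_one]
  rw [← ENNReal.ofReal_add hp.ℛ_nonneg (by linarith [hp.ℛ_le_one])]
  simp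

lemma markLaw_eq (p : Params) : p.markLaw = (uniformOn (Set.univ : Set (Fin p.S))).prod
    ((poissonMeasure p.μNew).prod ((accessLaw p).prod p.fadingLaw)) := rfl

lemma isProbabilityMeasure_markLaw (hp : p.Admissible s) : IsProbabilityMeasure p.markLaw := by
  have := isProbabilityMeasure_accessLaw hp
  have : Nonempty (Fin p.S) := ⟨⟨0, hp.S_pos⟩⟩
  rw [markLaw_eq]
  infer_instance

lemma activeProb_nonneg (hp : p.Admissible s) : 0 ≤ activeProb p :=
  div_nonneg (mul_nonneg (𝒜_nonneg p) hp.ℛ_nonneg) (Nat.cast_nonneg _)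

lemma poissonMeasure_pos (r : ℝ≥0) :
    poissonMeasure r (Set.Ioi 0) = ENNReal.ofReal (1 - Real.exp (-(r : ℝ))) := by
  have h : (Set.Ioi (0 : ℕ)) = {0}ᶜ := by
    ext n
    simp [Nat.pos_iff_ne_zero]
  rw [h, prob_compl_eq_one_sub (measurableSet_singleton 0), poissonMeasure_singleton,
    ENNReal.ofReal_sub _ (Real.exp_pos _).le]
  simp

/-- Activity is a condition on the first three components of the mark, independent of the gains: the
indicator factors along the product measure. -/
lemma lintegral_activeMarks (hp : p.Admissible s) (s₀ : Fin p.S) {g : p.Gains → ℝ≥0∞}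
    (hg : Measurable g) :
    ∫⁻ m in activeMarks p s₀, g m.2.2.2 ∂p.markLaw
      = ENNReal.ofReal (activeProb p) * ∫⁻ h, g h ∂p.fadingLaw := by
  have := isProbabilityMeasure_accessLaw hp
  have : Nonempty (Fin p.S) := ⟨s₀⟩
  have h1 : ∀ m : p.Mark, (activeMarks p s₀).indicator (fun m => g m.2.2.2) m
      = ({s₀} : Set (Fin p.S)).indicator 1 m.1 * ((Set.Ioi (0 : ℕ)).indicator 1 m.2.1 *
        (({true} : Set Bool).indicator 1 m.2.2.1 * g m.2.2.2)) := by
    intro m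
    by_cases a : m.1 = s₀ <;> by_cases b : 0 < m.2.1 <;> by_cases c : m.2.2.1 = true <;>
      simp [activeMarks, a, b, c]
  rw [← lintegral_indicator (measurableSet_activeMarks p s₀), lintegral_congr h1, markLaw_eq]
  rw [lintegral_prod_mul (f := ({s₀} : Set (Fin p.S)).indicator 1)
      (g := fun m : ℕ × Bool × p.Gains => (Set.Ioi (0 : ℕ)).indicator 1 m.1 *
        (({true} : Set Bool).indicator 1 m.2.1 * g m.2.2)) (by fun_prop) ?_,
    lintegral_prod_mul (f := (Set.Ioi (0 : ℕ)).indicator 1)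
      (g := fun m : Bool × p.Gains => ({true} : Set Bool).indicator 1 m.1 * g m.2)
      (by fun_prop) ?_,
    lintegral_prod_mul (f := ({true} : Set Bool).indicator 1) (g := g) (by fun_prop)
      hg.aemeasurable]
  · rw [lintegral_indicator_one (measurableSet_singleton _), lintegral_indicator_one
      measurableSet_Ioi, lintegral_indicator_one (measurableSet_singleton _), poissonMeasure_pos,
      uniformOn_univ]
    have hS : (0 : ℝ) < p.S := by exact_mod_cast hp.S_pos
    have h2 : accessLaw p {true} = ENNReal.ofReal p.ℛ := by simp [accessLaw]
    rw [h2, ← mul_assoc, ← mul_assoc, Measure.count_singleton, Fintype.card_fin, activeProb,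
      ENNReal.ofReal_div_of_pos hS, ENNReal.ofReal_mul (𝒜_nonneg p), ENNReal.ofReal_natCast,
      Params.𝒜, one_div, ENNReal.div_eq_inv_mul, mul_assoc (p.S : ℝ≥0∞)⁻¹]
  · have : Measurable fun m : Bool × p.Gains => ({true} : Set Bool).indicator 1 m.1 * g m.2 :=
      ((measurable_of_countable (({true} : Set Bool).indicator 1)).comp measurable_fst).mul
        (hg.comp measurable_snd)
    exact this.aemeasurable
  · have : Measurable fun m : ℕ × Bool × p.Gains => (Set.Ioi (0 : ℕ)).indicator 1 m.1 *
        (({true} : Set Bool).indicator 1 m.2.1 * g m.2.2) :=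
      ((measurable_of_countable ((Set.Ioi (0 : ℕ)).indicator 1)).comp measurable_fst).mul
        (((measurable_of_countable (({true} : Set Bool).indicator 1)).comp
          (measurable_fst.comp measurable_snd)).mul
          (hg.comp (measurable_snd.comp measurable_snd)))
    exact this.aemeasurable

lemma markLaw_activeMarks (hp : p.Admissible s) (s₀ : Fin p.S) :
    p.markLaw (activeMarks p s₀) = ENNReal.ofReal (activeProb p) := by
  simpa using lintegral_activeMarks hp s₀ (g := fun _ => 1) measurable_const

lemma activeProb_le_one (hp : p.Admissible s) : activeProb p ≤ 1 := by
  have := isProbabilityMeasure_markLaw hp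
  have h := prob_le_one (μ := p.markLaw) (s := activeMarks p ⟨0, hp.S_pos⟩)
  rw [markLaw_activeMarks hp] at h
  simpa using h

/-! ### Polar coordinates in the plane -/

/-- Off the origin, Lebesgue measure is the product of the sphere measure and `y dy`; the circle has
mass `2π`, the dimension times the area of the unit disc. -/
lemma lintegral_norm_plane {f : ℝ → ℝ≥0∞} (hf : Measurable f) :
    ∫⁻ x : Plane, f ‖x‖
      = ENNReal.ofReal (2 * Real.pi) * ∫⁻ y in Set.Ioi (0 : ℝ), ENNReal.ofReal y * f y := by
  have hdim : Module.finrank ℝ Plane = 2 := by simp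
  have h1 : ∫⁻ x : Plane, f ‖x‖ = ∫⁻ x : ({(0 : Plane)}ᶜ : Set Plane), f ‖x.1‖
      ∂((volume : Measure Plane).comap (↑)) := by
    rw [lintegral_subtype_comap (measurableSet_singleton _).compl fun x : Plane => f ‖x‖,
      restrict_compl_singleton]
  have h2 : ∫⁻ x : ({(0 : Plane)}ᶜ : Set Plane), f ‖x.1‖ ∂((volume : Measure Plane).comap (↑))
      = ∫⁻ z, f z.2 ∂((volume : Measure Plane).toSphere.prod
          (Measure.volumeIoiPow (Module.finrank ℝ Plane - 1))) := by
    simpa using (volume : Measure Plane).measurePreserving_homeomorphUnitSphereProd.lintegral_comp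
      (f := fun z => f z.2) (hf.comp (measurable_subtype_coe.comp measurable_snd))
  have hf' : Measurable fun y : Set.Ioi (0 : ℝ) => f y := hf.comp measurable_subtype_coe
  have h3 : ∫⁻ z, f z.2 ∂((volume : Measure Plane).toSphere.prod
          (Measure.volumeIoiPow (Module.finrank ℝ Plane - 1)))
      = (volume : Measure Plane).toSphere Set.univ *
        ∫⁻ y : Set.Ioi (0 : ℝ), f y ∂(Measure.volumeIoiPow (Module.finrank ℝ Plane - 1)) := by
    rw [lintegral_prod _ (hf'.fun_comp measurable_snd).aemeasurable]
    simp only [lintegral_const]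
    rw [mul_comm]
  have h4 : ∫⁻ y : Set.Ioi (0 : ℝ), f y ∂(Measure.volumeIoiPow (Module.finrank ℝ Plane - 1))
      = ∫⁻ y in Set.Ioi (0 : ℝ), ENNReal.ofReal y * f y := by
    rw [Measure.volumeIoiPow, hdim, lintegral_withDensity_eq_lintegral_mul _
      (by fun_prop) hf',
      ← lintegral_subtype_comap measurableSet_Ioi fun y : ℝ => ENNReal.ofReal y * f y]
    simp
  have h5 : (volume : Measure Plane).toSphere Set.univ = ENNReal.ofReal (2 * Real.pi) := by
    rw [Measure.toSphere_apply_univ, hdim, EuclideanSpace.volume_ball_fin_two,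
      ENNReal.ofReal_mul zero_le_two]
    simp
  rw [h1, h2, h3, h4, h5]

lemma annulusDistLaw_eq {a b : ℝ} (ha : 0 < a) (hab : a < b) :
    Params.annulusDistLaw a b = (volume.restrict (Set.Icc a b)).withDensity
      (fun r => ENNReal.ofReal (2 * r / (b ^ 2 - a ^ 2))) := by
  have hd : 0 < b ^ 2 - a ^ 2 := by nlinarith
  have hAset : {x : Plane | a ≤ ‖x‖ ∧ ‖x‖ ≤ b} = (fun x : Plane => ‖x‖) ⁻¹' Set.Icc a b := rfl
  have hA : MeasurableSet {x : Plane | a ≤ ‖x‖ ∧ ‖x‖ ≤ b} :=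
    measurableSet_Icc.preimage measurable_norm
  -- Polar coordinates for an indicator; `B = Set.univ` then gives the normalizing area.
  have key : ∀ B : Set ℝ, MeasurableSet B →
      volume ((fun x : Plane => ‖x‖) ⁻¹' (Set.Icc a b ∩ B))
        = ENNReal.ofReal (2 * Real.pi) * ∫⁻ r in Set.Icc a b ∩ B, ENNReal.ofReal r := by
    intro B hB
    have hm : MeasurableSet (Set.Icc a b ∩ B) := measurableSet_Icc.inter hB
    rw [← lintegral_indicator_one (hm.preimage measurable_norm)]
    have := lintegral_norm_plane (f := (Set.Icc a b ∩ B).indicator 1)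
      (measurable_one.indicator hm)
    refine this.trans ?_
    congr 1
    have h1 : ∀ y : ℝ, ENNReal.ofReal y * (Set.Icc a b ∩ B).indicator 1 y
        = (Set.Icc a b ∩ B).indicator (fun y => ENNReal.ofReal y) y := by
      intro y
      by_cases hy : y ∈ Set.Icc a b ∩ B
      · simp only [Set.indicator_of_mem hy, Pi.one_apply, mul_one]
      · simp only [Set.indicator_of_notMem hy, mul_zero]
    simp_rw [h1]
    rw [setLIntegral_indicator hm, Set.inter_eq_left.2]
    exact fun y hy => ha.trans_le hy.1.1
  have hvol : volume {x : Plane | a ≤ ‖x‖ ∧ ‖x‖ ≤ b}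
      = ENNReal.ofReal (2 * Real.pi) * ENNReal.ofReal ((b ^ 2 - a ^ 2) / 2) := by
    have h1 := key Set.univ MeasurableSet.univ
    rw [Set.inter_univ] at h1
    rw [hAset, h1, ← ofReal_integral_eq_lintegral_ofReal
      (continuous_id'.integrableOn_Icc)
      ((ae_restrict_mem measurableSet_Icc).mono fun y hy => ha.le.trans hy.1),
      integral_Icc_eq_integral_Ioc, ← intervalIntegral.integral_of_le hab.le]
    simp [integral_id]
  ext B hB
  rw [Params.annulusDistLaw, Measure.map_apply measurable_norm hB, cond_apply hA, hvol,
    withDensity_apply _ hB, Measure.restrict_restrict hB, hAset, ← Set.preimage_inter, key B hB,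
    Set.inter_comm B]
  have h2 : ∀ r, ENNReal.ofReal (2 * r / (b ^ 2 - a ^ 2))
      = ENNReal.ofReal (2 / (b ^ 2 - a ^ 2)) * ENNReal.ofReal r := by
    intro r
    rw [← ENNReal.ofReal_mul (by positivity)]
    ring_nf
  simp_rw [h2]
  rw [lintegral_const_mul _ (by fun_prop), ← mul_assoc, ← ENNReal.ofReal_mul (by positivity),
    ← ENNReal.ofReal_inv_of_pos (by positivity), ← ENNReal.ofReal_mul (by positivity)]
  congr 2
  have := Real.pi_pos
  field_simp

/-! ### The serving distance -/

lemma D₁_pos (hp : p.Admissible s) : 0 < p.D₁ :=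
  Real.rpow_pos_of_pos (div_pos (mul_pos hp.δ₂_pos hp.ω₀_pos) hp.PDL_pos) _

lemma D₀_pos (hp : p.Admissible s) : 0 < p.D₀ :=
  Real.rpow_pos_of_pos (div_pos (mul_pos (hp.δ₂_pos.trans hp.δ₂_lt_δ₁) hp.ω₀_pos) hp.PDL_pos) _

lemma D₂_pos (hp : p.Admissible s) : 0 < p.D₂ :=
  one_div_pos.2 (Real.sqrt_pos.2 (mul_pos Real.pi_pos hp.lamB_pos))

lemma D₀_lt_D₁ (hp : p.Admissible s) : p.D₀ < p.D₁ := by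
  have hα : 0 < p.α := by linarith [hp.two_lt_α]
  -- The exponent `-1/α` is negative, so the larger threshold gives the smaller radius.
  refine Real.rpow_lt_rpow_of_neg (div_pos (mul_pos hp.δ₂_pos hp.ω₀_pos) hp.PDL_pos) ?_ ?_
  · have := hp.ω₀_pos
    have := hp.PDL_pos
    have := hp.δ₂_lt_δ₁
    gcongr
  · simpa using hα

lemma interfererRadius_pos (hp : p.Admissible s) : 0 < p.interfererRadius s := by
  cases s
  · exact D₁_pos hp
  · exact D₂_pos hp
  · exact D₁_pos hp

lemma pos_of_mem_distRange (hp : p.Admissible s) {r : ℝ} (hr : r ∈ p.distRange s) : 0 < r := by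
  cases s
  · exact (D₀_pos hp).trans_le hr.1
  · exact (D₁_pos hp).trans_le hr.1
  · exact (D₁_pos hp).trans_le hr

lemma measurableSet_distRange : MeasurableSet (p.distRange s) := by
  cases s
  · exact measurableSet_Icc
  · exact measurableSet_Icc
  · exact measurableSet_Ici

lemma measurable_fR : Measurable (p.fR s) := by
  cases s <;> (unfold Params.fR; fun_prop)

lemma fR_nonneg (hp : p.Admissible s) {r : ℝ} (hr : 0 < r) : 0 ≤ p.fR s r := by
  cases s
  · have h1 := D₀_lt_D₁ hp
    have h0 := D₀_pos hp
    exact div_nonneg (by positivity) (by nlinarith)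
  · have h1 := hp.D₁_lt_D₂ rfl
    have h0 := D₁_pos hp
    exact div_nonneg (by positivity) (by nlinarith)
  · have := hp.lamB_pos
    simp only [Params.fR]
    positivity

lemma servingLaw_eq (hp : p.Admissible s) : p.servingLaw s =
    (volume.restrict (p.distRange s)).withDensity (fun r => ENNReal.ofReal (p.fR s r)) := by
  cases s
  · exact annulusDistLaw_eq (D₀_pos hp) (D₀_lt_D₁ hp)
  · exact annulusDistLaw_eq (D₁_pos hp) (hp.D₁_lt_D₂ rfl)
  · rfl

lemma lamGroup_pos (hp : p.Admissible s) : 0 < p.lamGroup s := by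
  have hB := hp.lamB_pos
  have hD := hp.lamD_pos
  have hπ := Real.pi_pos
  have h : ∀ a b : ℝ, 0 < a → a < b →
      0 < (Real.exp (-(p.lamB * Real.pi * a ^ 2)) - Real.exp (-(p.lamB * Real.pi * b ^ 2)))
        * p.lamD := by
    intro a b ha hab
    refine mul_pos (sub_pos.2 (Real.exp_lt_exp.2 (neg_lt_neg ?_))) hD
    have : a ^ 2 < b ^ 2 := by nlinarith
    have : 0 < p.lamB * Real.pi := by positivity
    nlinarith
  cases s
  · exact h _ _ (D₀_pos hp) (D₀_lt_D₁ hp)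
  · exact h _ _ (D₁_pos hp) (hp.D₁_lt_D₂ rfl)
  · exact mul_pos (Real.exp_pos _) hD

/-! ### The integrals `ℱ` -/

/-- The probability that an interferer at distance `y` disturbs one of `l` symbol groups of a device
at distance `r`. -/
def blockProb (p : Params) (l : ℕ) (r y : ℝ) : ℝ :=
  1 - (1 / (1 + p.γth * r ^ p.α * y ^ (-p.α))) ^ l

lemma FIntegrand_eq (l : ℕ) (r y : ℝ) : p.FIntegrand l r y = blockProb p l r y * y := rfl

lemma measurable_blockProb (l : ℕ) : Measurable fun z : ℝ × ℝ => blockProb p l z.1 z.2 := by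
  unfold blockProb
  fun_prop

lemma measurable_blockProb_right (l : ℕ) (r : ℝ) : Measurable (blockProb p l r) := by
  unfold blockProb
  fun_prop

lemma relGain_nonneg (hp : p.Admissible s) {r y : ℝ} (hr : 0 ≤ r) (hy : 0 ≤ y) :
    0 ≤ p.γth * r ^ p.α * y ^ (-p.α) :=
  mul_nonneg (mul_nonneg hp.γth_pos.le (Real.rpow_nonneg hr _)) (Real.rpow_nonneg hy _)

lemma blockProb_nonneg (hp : p.Admissible s) (l : ℕ) {r y : ℝ} (hr : 0 ≤ r) (hy : 0 ≤ y) :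
    0 ≤ blockProb p l r y := by
  have h := relGain_nonneg hp hr hy
  refine sub_nonneg.2 (pow_le_one₀ (by positivity) ?_)
  rw [div_le_one (by linarith)]
  linarith

lemma blockProb_le_one (hp : p.Admissible s) (l : ℕ) {r y : ℝ} (hr : 0 ≤ r) (hy : 0 ≤ y) :
    blockProb p l r y ≤ 1 := by
  have h := relGain_nonneg hp hr hy
  refine sub_le_self _ (by positivity)

/-- Bernoulli's inequality for `1 / (1 + u) = 1 - u / (1 + u)`; the bound supplies the decay `y ^
(-α)` at infinity. -/
lemma blockProb_le (hp : p.Admissible s) (l : ℕ) {r y : ℝ} (hr : 0 ≤ r) (hy : 0 ≤ y) :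
    blockProb p l r y ≤ l * (p.γth * r ^ p.α * y ^ (-p.α)) := by
  have h := relGain_nonneg hp hr hy
  unfold blockProb
  set u := p.γth * r ^ p.α * y ^ (-p.α)
  have h0 : 0 < 1 + u := by linarith
  have h1 : 1 / (1 + u) = 1 + (-(u / (1 + u))) := by field_simp; ring
  have h2 : u / (1 + u) ≤ 1 := by rw [div_le_one h0]; linarith
  have h3 : u / (1 + u) ≤ u := by rw [div_le_iff₀ h0]; nlinarith
  have h4 := one_add_mul_le_pow (a := -(u / (1 + u))) (by linarith) l
  rw [h1]
  have h5 : (l : ℝ) * (u / (1 + u)) ≤ l * u := by gcongr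
  linarith

/-- The integrand is at most a multiple of `y ^ (1 - α)`, integrable away from `0` because `α > 2`.
-/
lemma integrableOn_FIntegrand (hp : p.Admissible s) (l : ℕ) {r : ℝ} (hr : 0 < r) :
    IntegrableOn (p.FIntegrand l r) (Set.Ioi (p.interfererRadius s)) := by
  have hD := interfererRadius_pos hp
  have hα := hp.two_lt_α
  have hint : IntegrableOn (fun y : ℝ => (l * (p.γth * r ^ p.α)) * y ^ (1 - p.α))
      (Set.Ioi (p.interfererRadius s)) :=
    (integrableOn_Ioi_rpow_of_lt (by linarith) hD).const_mul _
  refine Integrable.mono' hint ?_ ?_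
  · exact ((measurable_blockProb_right l r).mul measurable_id).aestronglyMeasurable
  · filter_upwards [ae_restrict_mem measurableSet_Ioi] with y hy
    have hy0 : 0 < y := hD.trans hy
    rw [FIntegrand_eq, Real.norm_of_nonneg (mul_nonneg (blockProb_nonneg hp l hr.le hy0.le) hy0.le)]
    have h1 : y ^ (1 - p.α) = y ^ (-p.α) * y := by
      rw [show 1 - p.α = -p.α + 1 by ring, Real.rpow_add_one hy0.ne']
    rw [h1]
    have := mul_le_mul_of_nonneg_right (blockProb_le hp l hr.le hy0.le) hy0.le
    linarith

lemma measurable_F (l : ℕ) : Measurable (p.F s l) := by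
  have h : StronglyMeasurable (Function.uncurry (p.FIntegrand l)) :=
    ((measurable_blockProb l).mul measurable_snd).stronglyMeasurable
  exact (h.integral_prod_right (ν := volume.restrict (Set.Ioi (p.interfererRadius s)))).measurable

lemma FIntegrand_nonneg (hp : p.Admissible s) (l : ℕ) {r y : ℝ} (hr : 0 ≤ r) (hy : 0 ≤ y) :
    0 ≤ p.FIntegrand l r y :=
  mul_nonneg (blockProb_nonneg hp l hr hy) hy

lemma F_nonneg (hp : p.Admissible s) (l : ℕ) {r : ℝ} (hr : 0 ≤ r) : 0 ≤ p.F s l r :=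
  setIntegral_nonneg measurableSet_Ioi fun _ hy =>
    FIntegrand_nonneg hp l hr ((interfererRadius_pos hp).trans hy).le

lemma lintegral_blockProb (hp : p.Admissible s) (l : ℕ) {r : ℝ} (hr : 0 < r) :
    ∫⁻ x : Plane, ENNReal.ofReal
        ((Set.Ioi (p.interfererRadius s)).indicator (blockProb p l r) ‖x‖)
      = ENNReal.ofReal (2 * Real.pi * p.F s l r) := by
  have hD := interfererRadius_pos hp
  have hF : ENNReal.ofReal (p.F s l r)
      = ∫⁻ y in Set.Ioi (p.interfererRadius s), ENNReal.ofReal (p.FIntegrand l r y) :=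
    ofReal_integral_eq_lintegral_ofReal (integrableOn_FIntegrand hp l hr)
      ((ae_restrict_mem measurableSet_Ioi).mono fun y hy =>
        FIntegrand_nonneg hp l hr.le (hD.trans hy).le)
  have hm : Measurable (blockProb p l r) := measurable_blockProb_right l r
  have hI : ∀ y, p.FIntegrand l r y = blockProb p l r y * y := fun y => FIntegrand_eq l r y
  rw [ENNReal.ofReal_mul (by positivity), hF]
  simp_rw [hI]
  -- From here only the measurability of the function and the positivity of the radius matter.
  generalize blockProb p l r = g at hm
  generalize p.interfererRadius s = D at hD
  have h0 : Measurable fun y => ENNReal.ofReal ((Set.Ioi D).indicator g y) :=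
    (hm.indicator measurableSet_Ioi).ennreal_ofReal
  have h1 : ∀ y ∈ Set.Ioi (0 : ℝ), ENNReal.ofReal y * ENNReal.ofReal ((Set.Ioi D).indicator g y)
      = (Set.Ioi D).indicator (fun y => ENNReal.ofReal (g y * y)) y := by
    intro y hy
    by_cases h : y ∈ Set.Ioi D
    · rw [Set.indicator_of_mem h, Set.indicator_of_mem h, ← ENNReal.ofReal_mul (le_of_lt hy),
        mul_comm]
    · rw [Set.indicator_of_notMem h, Set.indicator_of_notMem h, ENNReal.ofReal_zero, mul_zero]
  rw [lintegral_norm_plane h0, setLIntegral_congr_fun measurableSet_Ioi h1,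
    setLIntegral_indicator measurableSet_Ioi, Set.inter_eq_left.2 (Set.Ioi_subset_Ioi hD.le)]

/-! ### The integrand in the serving distance -/

/-- The exponential factor of `Params.outerIntegrand`. -/
def coverProb (p : Params) (s : Scenario) (l : ℕ) (r : ℝ) : ℝ :=
  Real.exp (-((l : ℝ) * p.γth * p.σ ^ 2 * r ^ p.α / p.P)
    - 2 * Real.pi * (p.𝒜 * p.ℛ * p.lamA s) * p.F s l r)

lemma outerIntegrand_eq (l : ℕ) (r : ℝ) :
    p.outerIntegrand s l r = coverProb p s l r * p.fR s r := rfl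

lemma measurable_coverProb (l : ℕ) : Measurable (coverProb p s l) := by
  have := measurable_F (p := p) (s := s) l
  unfold coverProb
  fun_prop

lemma measurable_outerIntegrand (l : ℕ) : Measurable (p.outerIntegrand s l) :=
  (measurable_coverProb l).mul measurable_fR

lemma lamA_nonneg (hp : p.Admissible s) : 0 ≤ p.lamA s :=
  div_nonneg (lamGroup_pos hp).le (Nat.cast_nonneg _)

lemma activeIntensity_nonneg (hp : p.Admissible s) : 0 ≤ p.𝒜 * p.ℛ * p.lamA s :=
  mul_nonneg (mul_nonneg (𝒜_nonneg p) hp.ℛ_nonneg) (lamA_nonneg hp)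

lemma coverProb_le_one (hp : p.Admissible s) (l : ℕ) {r : ℝ} (hr : 0 ≤ r) :
    coverProb p s l r ≤ 1 := by
  have h1 := F_nonneg hp l hr
  have h2 := activeIntensity_nonneg hp
  have h3 := hp.γth_pos
  have h4 := hp.P_pos
  have h5 := Real.rpow_nonneg hr p.α
  have h6 : 0 ≤ (l : ℝ) * p.γth * p.σ ^ 2 * r ^ p.α / p.P := by positivity
  have h7 : 0 ≤ 2 * Real.pi * (p.𝒜 * p.ℛ * p.lamA s) * p.F s l r :=
    mul_nonneg (mul_nonneg (by positivity) h2) h1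
  exact Real.exp_le_one_iff.2 (by linarith)

lemma outerIntegrand_nonneg (hp : p.Admissible s) (l : ℕ) {r : ℝ} (hr : 0 < r) :
    0 ≤ p.outerIntegrand s l r :=
  mul_nonneg (Real.exp_pos _).le (fR_nonneg hp hr)

lemma lintegral_fR (hp : p.Admissible s) :
    ∫⁻ r in p.distRange s, ENNReal.ofReal (p.fR s r) = p.servingLaw s Set.univ := by
  rw [servingLaw_eq hp, withDensity_apply _ MeasurableSet.univ, Measure.restrict_univ]

/-- The exponential factor is at most one, and the integral of `f_R` is the mass of the serving law,
so finiteness of that law suffices in all scenarios. -/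
lemma integrableOn_outerIntegrand (hp : p.Admissible s) [IsFiniteMeasure (p.servingLaw s)]
    (l : ℕ) : IntegrableOn (p.outerIntegrand s l) (p.distRange s) := by
  have hpos : ∀ᵐ r ∂(volume.restrict (p.distRange s)), 0 < r :=
    (ae_restrict_mem measurableSet_distRange).mono fun r hr => pos_of_mem_distRange hp hr
  have hfR : IntegrableOn (p.fR s) (p.distRange s) := by
    refine ⟨measurable_fR.aestronglyMeasurable, ?_⟩
    rw [hasFiniteIntegral_iff_ofReal (hpos.mono fun r hr => fR_nonneg hp hr), lintegral_fR hp]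
    exact measure_lt_top _ _
  refine Integrable.mono' hfR (measurable_outerIntegrand l).aestronglyMeasurable ?_
  filter_upwards [hpos] with r hr
  rw [Real.norm_of_nonneg (outerIntegrand_nonneg hp l hr)]
  exact mul_le_of_le_one_left (fR_nonneg hp hr) (coverProb_le_one hp l hr.le)

lemma lintegral_coverProb_servingLaw (hp : p.Admissible s) [IsFiniteMeasure (p.servingLaw s)]
    (l : ℕ) : ∫⁻ r, ENNReal.ofReal (coverProb p s l r) ∂(p.servingLaw s)
      = ENNReal.ofReal (∫ r in p.distRange s, p.outerIntegrand s l r) := by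
  have hpos : ∀ᵐ r ∂(volume.restrict (p.distRange s)), 0 < r :=
    (ae_restrict_mem measurableSet_distRange).mono fun r hr => pos_of_mem_distRange hp hr
  rw [servingLaw_eq hp, lintegral_withDensity_eq_lintegral_mul _ measurable_fR.ennreal_ofReal
    (measurable_coverProb l).ennreal_ofReal, ofReal_integral_eq_lintegral_ofReal
      (integrableOn_outerIntegrand hp l) (hpos.mono fun r hr => outerIntegrand_nonneg hp l hr)]
  refine lintegral_congr fun r => ?_
  rw [Pi.mul_apply, mul_comm, outerIntegrand_eq, ENNReal.ofReal_mul]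
  exact (Real.exp_pos _).le

/-! ### The number of intra-group interferers -/

lemma load_nonneg (hp : p.Admissible s) : 0 ≤ p.load s :=
  div_nonneg (activeIntensity_nonneg hp) hp.lamB_pos.le

lemma c_pos : 0 < Params.c := by norm_num [Params.c]

/-- Poisson weight times Gamma density is a constant times `x ^ (n + c) * exp (-(a + c) x)`: a Gamma
integral of shape `n + c + 1` and rate `a + c`. -/
lemma integral_poisson_gammaMeasure {a c : ℝ} (ha : 0 ≤ a) (hc : 0 < c) (n : ℕ) :
    ∫ x, Real.exp (-(a * x)) * (a * x) ^ n / (Nat.factorial n : ℝ) ∂(gammaMeasure (c + 1) c)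
      = c ^ (c + 1) * Real.Gamma (n + c + 1) * a ^ n /
        (Real.Gamma (c + 1) * Real.Gamma (n + 1) * (a + c) ^ ((n : ℝ) + c + 1)) := by
  have hac : 0 < a + c := by linarith
  have hG : 0 < Real.Gamma (c + 1) := Real.Gamma_pos_of_pos (by linarith)
  have hpdf : ∀ x, 0 ≤ gammaPDFReal (c + 1) c x := fun x =>
    gammaPDFReal_nonneg (by linarith) hc x
  rw [gammaMeasure, integral_withDensity_eq_integral_toReal_smul
    (f := gammaPDF (c + 1) c) (measurable_gammaPDFReal _ _).ennreal_ofReal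
    (Filter.Eventually.of_forall fun x => by simp [gammaPDF])]
  have h1 : ∀ x : ℝ, (gammaPDF (c + 1) c x).toReal •
      (Real.exp (-(a * x)) * (a * x) ^ n / (Nat.factorial n : ℝ))
      = (Set.Ici (0 : ℝ)).indicator (fun x => gammaPDFReal (c + 1) c x *
        (Real.exp (-(a * x)) * (a * x) ^ n / (Nat.factorial n : ℝ))) x := by
    intro x
    rw [gammaPDF, ENNReal.toReal_ofReal (hpdf x), smul_eq_mul]
    by_cases hx : 0 ≤ x
    · rw [Set.indicator_of_mem (by exact hx)]
    · rw [Set.indicator_of_notMem (by exact hx), gammaPDFReal, if_neg hx, zero_mul]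
  rw [integral_congr_ae (Filter.Eventually.of_forall h1), integral_indicator measurableSet_Ici,
    integral_Ici_eq_integral_Ioi]
  have h2 : ∀ x ∈ Set.Ioi (0 : ℝ), gammaPDFReal (c + 1) c x *
        (Real.exp (-(a * x)) * (a * x) ^ n / (Nat.factorial n : ℝ))
      = c ^ (c + 1) / Real.Gamma (c + 1) * a ^ n / (Nat.factorial n : ℝ) *
        (x ^ ((n : ℝ) + c + 1 - 1) * Real.exp (-((a + c) * x))) := by
    intro x hx
    have hx0 : (0 : ℝ) < x := hx
    rw [gammaPDFReal, if_pos hx0.le, show (n : ℝ) + c + 1 - 1 = (c + 1 - 1) + n by ring,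
      Real.rpow_add_natCast hx0.ne', show -((a + c) * x) = -(c * x) + -(a * x) by ring,
      Real.exp_add, mul_pow]
    ring
  rw [setIntegral_congr_fun measurableSet_Ioi h2, integral_const_mul,
    Real.integral_rpow_mul_exp_neg_mul_Ioi (by positivity) hac, Real.Gamma_nat_eq_factorial,
    Real.div_rpow zero_le_one hac.le, Real.one_rpow]
  have h3 : 0 < (a + c) ^ ((n : ℝ) + c + 1) := Real.rpow_pos_of_pos hac _
  have h4 : (0 : ℝ) < Nat.factorial n := by positivity
  field_simp

/-! ### Independence and joint laws -/

section Joint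

variable {Ω 𝒰 𝒱 𝒲 : Type*} [MeasurableSpace Ω] [MeasurableSpace 𝒰] [MeasurableSpace 𝒱]
  [MeasurableSpace 𝒲] {μ : Measure Ω} [IsProbabilityMeasure μ]

/-- The hypotheses make the joint law a product of three laws, and permuting factors preserves this.
It regroups the nested independence assumptions of `Model`. -/
lemma indepFun_rotate {U : Ω → 𝒰} {V : Ω → 𝒱} {W : Ω → 𝒲} (hU : Measurable U)
    (hV : Measurable V) (hW : Measurable W) (h : IndepFun U (fun ω => (V ω, W ω)) μ)
    (h' : IndepFun V W μ) : IndepFun W (fun ω => (V ω, U ω)) μ := by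
  have := Measure.isProbabilityMeasure_map (μ := μ) hU.aemeasurable
  have := Measure.isProbabilityMeasure_map (μ := μ) hV.aemeasurable
  have := Measure.isProbabilityMeasure_map (μ := μ) hW.aemeasurable
  have hVU : IndepFun V U μ := (h.comp (φ := id) (ψ := Prod.fst) measurable_id measurable_fst).symm
  have e1 := (indepFun_iff_map_prod_eq_prod_map_map hU.aemeasurable
    (hV.prodMk hW).aemeasurable).1 h
  rw [(indepFun_iff_map_prod_eq_prod_map_map hV.aemeasurable hW.aemeasurable).1 h'] at e1
  rw [indepFun_iff_map_prod_eq_prod_map_map hW.aemeasurable (hV.prodMk hU).aemeasurable,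
    (indepFun_iff_map_prod_eq_prod_map_map hV.aemeasurable hU.aemeasurable).1 hVU]
  -- The rearrangement is `(U, (V, W)) ↦ ((V, W), U) ↦ ((W, V), U) ↦ (W, (V, U))`.
  have mp := (measurePreserving_prodAssoc (μ.map W) (μ.map V) (μ.map U)).comp
    (((Measure.measurePreserving_swap (μ := μ.map V) (ν := μ.map W)).prod
      (MeasurePreserving.id (μ.map U))).comp
      (Measure.measurePreserving_swap (μ := μ.map U) (ν := (μ.map V).prod (μ.map W))))
  rw [← mp.map_eq, ← e1, Measure.map_map mp.measurable (hU.prodMk (hV.prodMk hW))]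
  rfl

end Joint

/-! ### The Laplace functional of an independently marked Poisson process -/

section Marked

variable {Ω E : Type*} [MeasurableSpace Ω] [MeasurableSpace E] {μ : Measure Ω}
  [IsProbabilityMeasure μ] {κ : Measure E} {M : ℕ → Ω → E}

/-- Independence factors the finite products, and both sides are their limits. `negLog` writes the
infinite product as `expNeg` of a sum, ready for the Poisson Laplace functional. -/
lemma lintegral_expNeg_tsum_marks (hM : ∀ j, Measurable (M j)) (hlaw : ∀ j, μ.map (M j) = κ)
    (hind : iIndepFun M μ) {f : ℕ → E → ℝ≥0∞} (hf : ∀ j, Measurable (f j)) :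
    ∫⁻ ω, expNeg (∑' j, f j (M j ω)) ∂μ
      = expNeg (∑' j, negLog (∫⁻ m, expNeg (f j m) ∂κ)) := by
  have : IsProbabilityMeasure κ := hlaw 0 ▸ Measure.isProbabilityMeasure_map (hM 0).aemeasurable
  have hle : ∀ j, ∫⁻ m, expNeg (f j m) ∂κ ≤ 1 := fun j => by
    calc ∫⁻ m, expNeg (f j m) ∂κ ≤ ∫⁻ _, 1 ∂κ := lintegral_mono fun m => expNeg_le_one _
      _ = 1 := by simp
  have h1 : Filter.Tendsto (fun n => ∫⁻ ω, ∏ j ∈ Finset.range n, expNeg (f j (M j ω)) ∂μ)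
      Filter.atTop (nhds (∫⁻ ω, expNeg (∑' j, f j (M j ω)) ∂μ)) := by
    refine tendsto_lintegral_of_dominated_convergence (fun _ => 1) (fun n => ?_)
      (fun n => Filter.Eventually.of_forall fun ω => ?_) (by simp)
      (Filter.Eventually.of_forall fun ω => tendsto_prod_expNeg _)
    · exact Finset.measurable_prod _ fun j _ => measurable_expNeg.comp ((hf j).comp (hM j))
    · simp only
      rw [← expNeg_sum]
      exact expNeg_le_one _
  have h2 := tendsto_prod_expNeg fun j => negLog (∫⁻ m, expNeg (f j m) ∂κ)
  refine tendsto_nhds_unique h1 (h2.congr fun n => ?_)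
  have hind' : iIndepFun (fun j ω => expNeg (f j (M j ω))) μ :=
    hind.comp (fun j m => expNeg (f j m)) fun j => measurable_expNeg.comp (hf j)
  rw [lintegral_prod_eq_prod_lintegral_of_indepFun _ _ hind'
    fun j => measurable_expNeg.comp ((hf j).comp (hM j))]
  refine Finset.prod_congr rfl fun j _ => ?_
  rw [expNeg_negLog (hle j), ← hlaw j]
  exact (lintegral_map (μ := μ) (measurable_expNeg.comp (hf j)) (hM j))

/-- The Laplace functional of an independently marked homogeneous Poisson process. -/
theorem IsPoissonProcess.lintegral_expNeg_marked {X : ℕ → Ω → Plane} {lam : ℝ}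
    (h : IsPoissonProcess X lam μ) (hlam : 0 ≤ lam)
    (hM : ∀ j, Measurable (M j)) (hlaw : ∀ j, μ.map (M j) = κ) (hind : iIndepFun M μ)
    {ψ : Plane × E → ℝ≥0∞} (hψ : Measurable ψ) :
    ∫⁻ x : ℕ → Plane, ∫⁻ m : ℕ → E, expNeg (∑' j, ψ (x j, m j))
        ∂(μ.map fun ω j => M j ω) ∂(μ.map fun ω j => X j ω)
      = expNeg (ENNReal.ofReal lam * ∫⁻ x, (1 - ∫⁻ m, expNeg (ψ (x, m)) ∂κ)) := by
  have : IsProbabilityMeasure κ := hlaw 0 ▸ Measure.isProbabilityMeasure_map (hM 0).aemeasurable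
  have hX := h.measurable
  have hMseq : Measurable fun ω j => M j ω := measurable_pi_lambda _ hM
  have hXseq : Measurable fun ω j => X j ω := measurable_pi_lambda _ hX
  have hG : Measurable fun x => ∫⁻ m, expNeg (ψ (x, m)) ∂κ :=
    (measurable_expNeg.comp hψ).lintegral_prod_right'
  -- Integrating the marks at fixed positions leaves an unmarked functional, with `-log` of the mean
  -- mark factor as test function.
  have h1 : ∀ x : ℕ → Plane, ∫⁻ m : ℕ → E, expNeg (∑' j, ψ (x j, m j)) ∂(μ.map fun ω j => M j ω)
      = expNeg (∑' j, negLog (∫⁻ m, expNeg (ψ (x j, m)) ∂κ)) := by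
    intro x
    rw [lintegral_map _ hMseq]
    · exact lintegral_expNeg_tsum_marks hM hlaw hind (f := fun j m => ψ (x j, m))
        fun j => hψ.comp measurable_prodMk_left
    · exact measurable_expNeg.comp (Measurable.tsum fun j =>
        hψ.comp (measurable_const.prodMk (measurable_pi_apply j)))
  simp_rw [h1]
  rw [lintegral_map _ hXseq]
  · rw [h.lintegral_expNeg_tsum hlam (f := fun x => negLog (∫⁻ m, expNeg (ψ (x, m)) ∂κ))
      (measurable_negLog.comp hG)]
    congr 2
    refine lintegral_congr fun x => ?_
    rw [expNeg_negLog]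
    calc ∫⁻ m, expNeg (ψ (x, m)) ∂κ ≤ ∫⁻ _, 1 ∂κ := lintegral_mono fun m => expNeg_le_one _
      _ = 1 := by simp
  · exact measurable_expNeg.comp (Measurable.tsum fun j =>
      measurable_negLog.comp (hG.comp (measurable_pi_apply j)))

end Marked

/-! ### The interference -/

/-- The contribution of a device at `x` with mark `m` to the interference during the symbol group
`b`. -/
def contrib (p : Params) (s : Scenario) (s₀ : Fin p.S) (b : p.Sym) : Plane × p.Mark → ℝ≥0∞ :=
  ({x : Plane | p.interfererRadius s < ‖x‖} ×ˢ activeMarks p s₀).indicator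
    fun z => ENNReal.ofReal (p.P * z.2.2.2.2 b * ‖z.1‖ ^ (-p.α))

lemma measurable_contrib (s₀ : Fin p.S) (b : p.Sym) : Measurable (contrib p s s₀ b) := by
  refine Measurable.indicator ?_ ?_
  · have : Measurable fun z : Plane × p.Mark => z.2.2.2.2 b :=
      (measurable_pi_apply b).comp (measurable_snd.comp (measurable_snd.comp
        (measurable_snd.comp measurable_snd)))
    fun_prop
  · exact (measurableSet_Ioi.preimage measurable_norm).prod (measurableSet_activeMarks p s₀)

/-- The interference as a function of the positions and marks. -/
def interferenceOf (p : Params) (s : Scenario) (s₀ : Fin p.S) (b : p.Sym) (x : ℕ → Plane)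
    (m : ℕ → p.Mark) : ℝ≥0∞ := ∑' j, contrib p s s₀ b (x j, m j)

lemma Model.interference_eq {s₀ : Fin p.S} {Ω : Type*} [MeasurableSpace Ω] {μ : Measure Ω}
    (A : Model p s s₀ μ) (b : p.Sym) (ω : Ω) :
    A.interference b ω = interferenceOf p s s₀ b (fun j => A.X j ω) (fun j => A.M j ω) := by
  rw [Model.interference, interferenceOf, tsum_subtype (A.interferers ω)
    (fun j => ENNReal.ofReal (p.P * (A.M j ω).2.2.2 b * ‖A.X j ω‖ ^ (-p.α)))]
  refine tsum_congr fun j => ?_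
  have h : j ∈ A.interferers ω ↔
      (A.X j ω, A.M j ω) ∈ ({x : Plane | p.interfererRadius s < ‖x‖} ×ˢ activeMarks p s₀) := by
    simp only [Model.interferers, activeMarks, Set.mem_prod, Set.mem_ofPred_eq]
    tauto
  by_cases hj : j ∈ A.interferers ω
  · rw [contrib, Set.indicator_of_mem hj, Set.indicator_of_mem (h.1 hj)]
  · rw [contrib, Set.indicator_of_notMem hj, Set.indicator_of_notMem fun h' => hj (h.2 h')]

/-- With `q` the activity probability, an inactive device contributes the factor `1`, an active one
`(1 / (1 + u)) ^ l`; the mean is `1 - q + q (1 / (1 + u)) ^ l`. Inside the disc the factor is always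
`1`. -/
lemma lintegral_expNeg_contrib (hp : p.Admissible s) (s₀ : Fin p.S) (T : Finset p.Sym) {r : ℝ}
    (hr : 0 < r) (x : Plane) :
    ∫⁻ m, expNeg (∑ b ∈ T, ENNReal.ofReal (p.γth * r ^ p.α / p.P) * contrib p s s₀ b (x, m))
        ∂p.markLaw
      = 1 - ENNReal.ofReal (activeProb p) * ENNReal.ofReal
          ((Set.Ioi (p.interfererRadius s)).indicator (blockProb p T.card r) ‖x‖) := by
  have := isProbabilityMeasure_markLaw hp
  have hP := hp.P_pos
  have hq := activeProb_nonneg hp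
  by_cases hx : p.interfererRadius s < ‖x‖
  · have hu := relGain_nonneg hp hr.le (norm_nonneg x)
    have ha : 0 ≤ p.γth * r ^ p.α / p.P :=
      div_nonneg (mul_nonneg hp.γth_pos.le (Real.rpow_nonneg hr.le _)) hP.le
    rw [Set.indicator_of_mem (by exact hx), blockProb]
    set u := p.γth * r ^ p.α * ‖x‖ ^ (-p.α) with hudef
    rw [← lintegral_add_compl _ (measurableSet_activeMarks p s₀)]
    have h1 : ∫⁻ m in activeMarks p s₀, expNeg (∑ b ∈ T,
        ENNReal.ofReal (p.γth * r ^ p.α / p.P) * contrib p s s₀ b (x, m)) ∂p.markLaw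
        = ENNReal.ofReal (activeProb p) * ENNReal.ofReal (1 / (1 + u)) ^ T.card := by
      rw [← lintegral_expNeg_fadingLaw p T hu, ← lintegral_activeMarks hp s₀
        (g := fun h => expNeg (∑ b ∈ T, ENNReal.ofReal (u * h b))) (by fun_prop)]
      refine setLIntegral_congr_fun (measurableSet_activeMarks p s₀) fun m hm => ?_
      congr 1
      refine Finset.sum_congr rfl fun b _ => ?_
      have hxm : (x, m) ∈ ({x : Plane | p.interfererRadius s < ‖x‖} ×ˢ activeMarks p s₀) :=
        ⟨hx, hm⟩
      rw [contrib, Set.indicator_of_mem hxm, ← ENNReal.ofReal_mul ha, hudef]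
      congr 1
      field_simp
    have h2 : ∫⁻ m in (activeMarks p s₀)ᶜ, expNeg (∑ b ∈ T,
        ENNReal.ofReal (p.γth * r ^ p.α / p.P) * contrib p s s₀ b (x, m)) ∂p.markLaw
        = 1 - ENNReal.ofReal (activeProb p) := by
      rw [← markLaw_activeMarks hp s₀, ← prob_compl_eq_one_sub (measurableSet_activeMarks p s₀),
        setLIntegral_congr_fun (g := fun _ => 1) (measurableSet_activeMarks p s₀).compl
          fun m hm => ?_]
      · simp
      · have h3 : ∀ b, contrib p s s₀ b (x, m) = 0 := fun b =>
          Set.indicator_of_notMem (fun h => hm (Set.mem_prod.1 h).2) _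
        simp [h3]
    have hv0 : 0 ≤ 1 / (1 + u) := by positivity
    have hq1 := activeProb_le_one hp
    rw [h1, h2, ← ENNReal.ofReal_pow hv0, ← ENNReal.ofReal_mul hq, ← ENNReal.ofReal_one,
      ← ENNReal.ofReal_sub _ hq, ← ENNReal.ofReal_mul hq,
      ← ENNReal.ofReal_add (mul_nonneg hq (pow_nonneg hv0 _)) (by linarith), ← ENNReal.ofReal_sub]
    · congr 1
      ring
    · have hb := blockProb_nonneg hp T.card hr.le (norm_nonneg x)
      exact mul_nonneg hq hb
  · have h3 : ∀ b m, contrib p s s₀ b (x, m) = 0 := fun b m =>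
      Set.indicator_of_notMem (fun h => hx (Set.mem_prod.1 h).1) _
    rw [Set.indicator_of_notMem (by exact hx)]
    simp [h3]

/-! ### The probability that given symbol groups are received -/

/-- The event that the symbol groups in `T` are received, as a set of distances, gains, marks and
positions. -/
def receivedSet (p : Params) (s : Scenario) (s₀ : Fin p.S) (T : Finset p.Sym) :
    Set (ℝ × p.Gains × (ℕ → p.Mark) × (ℕ → Plane)) :=
  {z | ∀ b ∈ T, ENNReal.ofReal p.γth ≤ ENNReal.ofReal (p.P * z.2.1 b * z.1 ^ (-p.α)) /
    (interferenceOf p s s₀ b z.2.2.2 z.2.2.1 + ENNReal.ofReal (p.σ ^ 2))}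

lemma measurable_interferenceOf (s₀ : Fin p.S) (b : p.Sym) :
    Measurable fun z : (ℕ → p.Mark) × (ℕ → Plane) => interferenceOf p s s₀ b z.2 z.1 :=
  Measurable.tsum fun j => (measurable_contrib s₀ b).comp
    (((measurable_pi_apply j).comp measurable_snd).prodMk
      ((measurable_pi_apply j).comp measurable_fst))

lemma measurableSet_receivedSet (s₀ : Fin p.S) (T : Finset p.Sym) :
    MeasurableSet (receivedSet p s s₀ T) := by
  have h : receivedSet p s s₀ T = ⋂ b ∈ T, {z | ENNReal.ofReal p.γth ≤
      ENNReal.ofReal (p.P * z.2.1 b * z.1 ^ (-p.α)) /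
        (interferenceOf p s s₀ b z.2.2.2 z.2.2.1 + ENNReal.ofReal (p.σ ^ 2))} := by
    ext z
    simp [receivedSet]
  rw [h]
  refine Finset.measurableSet_biInter _ fun b _ => measurableSet_le measurable_const ?_
  have h1 : Measurable fun z : ℝ × p.Gains × (ℕ → p.Mark) × (ℕ → Plane) =>
      interferenceOf p s s₀ b z.2.2.2 z.2.2.1 :=
    (measurable_interferenceOf s₀ b).comp (measurable_snd.comp measurable_snd)
  have h2 : Measurable fun z : ℝ × p.Gains × (ℕ → p.Mark) × (ℕ → Plane) => z.2.1 b :=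
    (measurable_pi_apply b).comp (measurable_fst.comp measurable_snd)
  fun_prop

/-- A positive, finite numerator makes clearing the denominator legitimate even when noise plus
interference is `0` or `∞`. -/
lemma le_SINR_iff (hp : p.Admissible s) {r g : ℝ} (hr : 0 < r) (hg : 0 < g) (I : ℝ≥0∞) :
    ENNReal.ofReal p.γth ≤ ENNReal.ofReal (p.P * g * r ^ (-p.α)) / (I + ENNReal.ofReal (p.σ ^ 2)) ↔
      ENNReal.ofReal (p.γth * r ^ p.α / p.P) * (I + ENNReal.ofReal (p.σ ^ 2))
        ≤ ENNReal.ofReal g := by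
  have hP := hp.P_pos
  have hγ := hp.γth_pos
  have hrα : 0 < r ^ p.α := Real.rpow_pos_of_pos hr _
  have hd : 0 < p.P / r ^ p.α := by positivity
  have h1 : p.P * g * r ^ (-p.α) = p.P / r ^ p.α * g := by
    rw [Real.rpow_neg hr.le]
    field_simp
  have h2 : ENNReal.ofReal p.γth
      = ENNReal.ofReal (p.P / r ^ p.α) * ENNReal.ofReal (p.γth * r ^ p.α / p.P) := by
    rw [← ENNReal.ofReal_mul hd.le]
    congr 1
    field_simp
  rw [ENNReal.le_div_iff_mul_le, h1, h2, ENNReal.ofReal_mul hd.le, mul_assoc,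
    ENNReal.mul_le_mul_iff_right]
  · simpa using hd
  · exact ENNReal.ofReal_ne_top
  · right
    rw [h1]
    simpa using mul_pos hd hg
  · right
    exact ENNReal.ofReal_ne_top

lemma fadingLaw_received (hp : p.Admissible s) (s₀ : Fin p.S) (T : Finset p.Sym) {r : ℝ}
    (hr : 0 < r) (m : ℕ → p.Mark) (x : ℕ → Plane) :
    p.fadingLaw {h | (r, h, m, x) ∈ receivedSet p s s₀ T}
      = ENNReal.ofReal (Real.exp (-((T.card : ℝ) * p.γth * p.σ ^ 2 * r ^ p.α / p.P))) *
        expNeg (∑' j, ∑ b ∈ T,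
          ENNReal.ofReal (p.γth * r ^ p.α / p.P) * contrib p s s₀ b (x j, m j)) := by
  have ha : 0 ≤ p.γth * r ^ p.α / p.P :=
    div_nonneg (mul_nonneg hp.γth_pos.le (Real.rpow_nonneg hr.le _)) hp.P_pos.le
  have h1 : p.fadingLaw {h | (r, h, m, x) ∈ receivedSet p s s₀ T}
      = p.fadingLaw {h | ∀ b ∈ T, ENNReal.ofReal (p.γth * r ^ p.α / p.P) *
          (interferenceOf p s s₀ b x m + ENNReal.ofReal (p.σ ^ 2)) ≤ ENNReal.ofReal (h b)} := by
    refine measure_congr ?_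
    -- `le_SINR_iff` needs positive gains, which holds almost surely.
    filter_upwards [ae_pos_fadingLaw p] with h hh
    exact propext (forall₂_congr fun b _ => le_SINR_iff hp hr (hh b) _)
  rw [h1, fadingLaw_forall_ge]
  simp_rw [mul_add, Finset.sum_add_distrib]
  rw [add_comm, expNeg_add]
  congr 1
  · rw [Finset.sum_const, ← ENNReal.ofReal_mul ha, ← ENNReal.ofReal_nsmul, expNeg_ofReal
      (by positivity), nsmul_eq_mul]
    congr 3
    ring
  · rw [Summable.tsum_finsetSum fun i _ => ENNReal.summable]
    simp_rw [ENNReal.tsum_mul_left]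
    rfl

lemma activeIntensity_eq : p.lamGroup s * activeProb p = p.𝒜 * p.ℛ * p.lamA s := by
  unfold activeProb Params.lamA
  ring

/-- All symbol groups of `T` enter one test function on marked points, which accounts for their
dependence through common positions and activity. -/
lemma lintegral_expNeg_interference (hp : p.Admissible s) {s₀ : Fin p.S} {Ω : Type*}
    [MeasurableSpace Ω] {μ : Measure Ω} [IsProbabilityMeasure μ] (A : Model p s s₀ μ)
    (T : Finset p.Sym) {r : ℝ} (hr : 0 < r) :
    ∫⁻ x : ℕ → Plane, ∫⁻ m : ℕ → p.Mark, expNeg (∑' j, ∑ b ∈ T,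
        ENNReal.ofReal (p.γth * r ^ p.α / p.P) * contrib p s s₀ b (x j, m j))
        ∂(μ.map fun ω j => A.M j ω) ∂(μ.map fun ω j => A.X j ω)
      = ENNReal.ofReal (Real.exp
          (-(2 * Real.pi * (p.𝒜 * p.ℛ * p.lamA s) * p.F s T.card r))) := by
  have hF := F_nonneg hp T.card hr.le
  have hI := activeIntensity_nonneg hp
  have hq := activeProb_nonneg hp
  rw [A.isPoisson_X.lintegral_expNeg_marked (lamGroup_pos hp).le A.measurable_M A.law_M A.indep_M
    (ψ := fun z => ∑ b ∈ T, ENNReal.ofReal (p.γth * r ^ p.α / p.P) * contrib p s s₀ b z)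
    (Finset.measurable_fun_sum _ fun b _ => (measurable_contrib s₀ b).const_mul _),
    ← expNeg_ofReal (mul_nonneg (mul_nonneg (by positivity) hI) hF)]
  congr 1
  have h1 : ∀ x : Plane, 1 - ∫⁻ m, expNeg (∑ b ∈ T, ENNReal.ofReal (p.γth * r ^ p.α / p.P) *
        contrib p s s₀ b (x, m)) ∂p.markLaw
      = ENNReal.ofReal (activeProb p) * ENNReal.ofReal
          ((Set.Ioi (p.interfererRadius s)).indicator (blockProb p T.card r) ‖x‖) := by
    intro x
    rw [lintegral_expNeg_contrib hp s₀ T hr x, ENNReal.sub_sub_cancel ENNReal.one_ne_top]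
    rw [← ENNReal.ofReal_mul hq, ENNReal.ofReal_le_one]
    refine mul_le_one₀ (activeProb_le_one hp) (Set.indicator_nonneg (fun y hy => ?_) _)
      (Set.indicator_le' (fun y hy => ?_) (fun _ _ => zero_le_one) _)
    · exact blockProb_nonneg hp _ hr.le ((interfererRadius_pos hp).trans hy).le
    · exact blockProb_le_one hp _ hr.le ((interfererRadius_pos hp).trans hy).le
  have h2 : Measurable fun x : Plane => ENNReal.ofReal
      ((Set.Ioi (p.interfererRadius s)).indicator (blockProb p T.card r) ‖x‖) :=
    (((measurable_blockProb_right _ r).indicator measurableSet_Ioi).comp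
      measurable_norm).ennreal_ofReal
  rw [lintegral_congr h1, lintegral_const_mul _ h2, lintegral_blockProb hp _ hr,
    ← ENNReal.ofReal_mul hq, ← ENNReal.ofReal_mul (lamGroup_pos hp).le, ← activeIntensity_eq]
  congr 1
  ring

/-! ### Joint laws and reception probabilities in the model -/

namespace Model

variable {p : Params} {s : Scenario} {s₀ : Fin p.S} {Ω : Type*} [MeasurableSpace Ω]
  {μ : Measure Ω} (A : Model p s s₀ μ)

lemma measurable_X_seq : Measurable fun ω j => A.X j ω :=
  measurable_pi_lambda _ A.isPoisson_X.measurable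

lemma measurable_M_seq : Measurable fun ω j => A.M j ω :=
  measurable_pi_lambda _ A.measurable_M

/-- The serving law is a marginal of the probability law of `(R 0, h 0)`, so `f_R` need not be
integrated by hand. -/
lemma isProbabilityMeasure_servingLaw {p : Params} {s : Scenario} {s₀ : Fin p.S} {Ω : Type*}
    [MeasurableSpace Ω] {μ : Measure Ω} [IsProbabilityMeasure μ] (A : Model p s s₀ μ) :
    IsProbabilityMeasure (p.servingLaw s) := by
  have h := Measure.isProbabilityMeasure_map (μ := μ)
    ((A.measurable_R 0).prodMk (A.measurable_h 0)).aemeasurable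
  rw [A.law_Rh 0] at h
  have h1 := h.measure_univ
  rw [← Set.univ_prod_univ, Measure.prod_prod, measure_univ (μ := p.fadingLaw), mul_one] at h1
  exact ⟨h1⟩

lemma map_R [IsProbabilityMeasure μ] (m : ℕ) : μ.map (A.R m) = p.servingLaw s := by
  have := A.isProbabilityMeasure_servingLaw
  have h := congrArg (Measure.map Prod.fst) (A.law_Rh m)
  rw [Measure.map_map measurable_fst ((A.measurable_R m).prodMk (A.measurable_h m)),
    Measure.map_fst_prod, measure_univ, one_smul] at h
  exact h

/-- The distance and the gains of a served device, with the marks and the positions of the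
interferers. -/
def device (m : ℕ) (ω : Ω) : ℝ × p.Gains × (ℕ → p.Mark) × (ℕ → Plane) :=
  (A.R m ω, A.h m ω, (fun j => A.M j ω), fun j => A.X j ω)

lemma measurable_device (m : ℕ) : Measurable (A.device m) :=
  (A.measurable_R m).prodMk ((A.measurable_h m).prodMk
    (A.measurable_M_seq.prodMk A.measurable_X_seq))

lemma map_device [IsProbabilityMeasure μ] (m : ℕ) : μ.map (A.device m) =
    (p.servingLaw s).prod (p.fadingLaw.prod
      ((μ.map fun ω j => A.M j ω).prod (μ.map fun ω j => A.X j ω))) := by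
  have := A.isProbabilityMeasure_servingLaw
  have := Measure.isProbabilityMeasure_map (μ := μ) A.measurable_M_seq.aemeasurable
  have := Measure.isProbabilityMeasure_map (μ := μ) A.measurable_X_seq.aemeasurable
  have hRh := (A.measurable_R m).prodMk (A.measurable_h m)
  have hφ : Measurable fun z : (ℕ → ℝ × p.Gains) × ℕ => z.1 m :=
    (measurable_pi_apply m).comp measurable_fst
  have i1 : IndepFun (fun ω j => X A j ω) (fun ω => ((fun j => A.M j ω), (A.R m ω, A.h m ω))) μ :=
    A.indep_X.comp (φ := id) (ψ := fun z : (ℕ → p.Mark) × (ℕ → ℝ × p.Gains) × ℕ =>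
      (z.1, z.2.1 m)) measurable_id (measurable_fst.prodMk (hφ.comp measurable_snd))
  have i2 : IndepFun (fun ω j => A.M j ω) (fun ω => (A.R m ω, A.h m ω)) μ :=
    A.indep_MRhN.comp (φ := id) (ψ := fun z : (ℕ → ℝ × p.Gains) × ℕ => z.1 m) measurable_id hφ
  have i3 := indepFun_rotate A.measurable_X_seq A.measurable_M_seq hRh i1 i2
  have i4 : IndepFun (fun ω j => A.M j ω) (fun ω j => A.X j ω) μ :=
    (i1.comp (φ := id) (ψ := Prod.fst) measurable_id measurable_fst).symm
  have e := (indepFun_iff_map_prod_eq_prod_map_map hRh.aemeasurable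
    (A.measurable_M_seq.prodMk A.measurable_X_seq).aemeasurable).1 i3
  rw [A.law_Rh m, (indepFun_iff_map_prod_eq_prod_map_map A.measurable_M_seq.aemeasurable
    A.measurable_X_seq.aemeasurable).1 i4] at e
  have mp := measurePreserving_prodAssoc (p.servingLaw s) p.fadingLaw
    ((μ.map fun ω j => A.M j ω).prod (μ.map fun ω j => A.X j ω))
  rw [← mp.map_eq, ← e, Measure.map_map mp.measurable
    (hRh.prodMk (A.measurable_M_seq.prodMk A.measurable_X_seq))]
  rfl

lemma indepFun_N_device [IsProbabilityMeasure μ]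
    (m : ℕ) : IndepFun A.N (A.device m) μ := by
  have hRh := (A.measurable_R m).prodMk (A.measurable_h m)
  have hφ : Measurable fun z : (ℕ → ℝ × p.Gains) × ℕ => (z.1 m, z.2) :=
    ((measurable_pi_apply m).comp measurable_fst).prodMk measurable_snd
  have i1 : IndepFun (fun ω j => A.X j ω)
      (fun ω => ((fun j => A.M j ω), ((A.R m ω, A.h m ω), A.N ω))) μ :=
    A.indep_X.comp (φ := id) (ψ := fun z : (ℕ → p.Mark) × (ℕ → ℝ × p.Gains) × ℕ =>
      (z.1, (z.2.1 m, z.2.2))) measurable_id (measurable_fst.prodMk (hφ.comp measurable_snd))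
  have i2 : IndepFun (fun ω j => A.M j ω) (fun ω => ((A.R m ω, A.h m ω), A.N ω)) μ :=
    A.indep_MRhN.comp (φ := id) (ψ := fun z : (ℕ → ℝ × p.Gains) × ℕ => (z.1 m, z.2))
      measurable_id hφ
  have i3 := indepFun_rotate A.measurable_X_seq A.measurable_M_seq (hRh.prodMk A.measurable_N) i1 i2
  have i4 : IndepFun (fun ω => (A.R m ω, A.h m ω)) A.N μ :=
    A.indep_RhN.comp (φ := fun z => z m) (ψ := id) (measurable_pi_apply m) measurable_id
  have i5 := indepFun_rotate (A.measurable_M_seq.prodMk A.measurable_X_seq) hRh A.measurable_N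
    i3.symm i4
  exact i5.comp (φ := id) (ψ := fun z : (ℝ × p.Gains) × (ℕ → p.Mark) × (ℕ → Plane) =>
    (z.1.1, z.1.2, z.2)) measurable_id (by fun_prop)

/-- The event that the symbol groups in `T` of the device `m` are received. -/
def received (m : ℕ) (T : Finset p.Sym) : Set Ω :=
  {ω | ∀ b ∈ T, ENNReal.ofReal p.γth ≤ A.SINR m b ω}

lemma received_eq (m : ℕ) (T : Finset p.Sym) :
    A.received m T = A.device m ⁻¹' receivedSet p s s₀ T := by
  ext ω
  simp only [received, receivedSet, SINR, A.interference_eq]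
  rfl

lemma measurableSet_received (m : ℕ) (T : Finset p.Sym) : MeasurableSet (A.received m T) := by
  rw [received_eq]
  exact A.measurable_device m (measurableSet_receivedSet s₀ T)

lemma measure_received [IsProbabilityMeasure μ]
    (hp : p.Admissible s) (m : ℕ) (T : Finset p.Sym) :
    μ (A.received m T) = ENNReal.ofReal (∫ r in p.distRange s, p.outerIntegrand s T.card r) := by
  have := A.isProbabilityMeasure_servingLaw
  have := Measure.isProbabilityMeasure_map (μ := μ) A.measurable_M_seq.aemeasurable
  have := Measure.isProbabilityMeasure_map (μ := μ) A.measurable_X_seq.aemeasurable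
  have hS := measurableSet_receivedSet (p := p) (s := s) s₀ T
  rw [received_eq, ← Measure.map_apply (A.measurable_device m) hS, A.map_device,
    Measure.prod_apply hS, ← lintegral_coverProb_servingLaw hp]
  have hpos : ∀ᵐ r ∂(p.servingLaw s), 0 < r := by
    rw [servingLaw_eq hp]
    refine (withDensity_absolutelyContinuous _ _).ae_le ?_
    exact (ae_restrict_mem measurableSet_distRange).mono fun r hr => pos_of_mem_distRange hp hr
  refine lintegral_congr_ae ?_
  filter_upwards [hpos] with r hr
  -- The gains are integrated first, with distance, marks and positions frozen.
  rw [Measure.prod_apply_symm (measurable_prodMk_left hS)]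
  have h1 : ∀ z : (ℕ → p.Mark) × (ℕ → Plane),
      p.fadingLaw ((fun h => (h, z)) ⁻¹' (Prod.mk r ⁻¹' receivedSet p s s₀ T))
      = ENNReal.ofReal (Real.exp (-((T.card : ℝ) * p.γth * p.σ ^ 2 * r ^ p.α / p.P))) *
        expNeg (∑' j, ∑ b ∈ T,
          ENNReal.ofReal (p.γth * r ^ p.α / p.P) * contrib p s s₀ b (z.2 j, z.1 j)) :=
    fun z => fadingLaw_received hp s₀ T hr z.1 z.2
  have h2 : Measurable fun z : (ℕ → p.Mark) × (ℕ → Plane) => expNeg (∑' j, ∑ b ∈ T,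
      ENNReal.ofReal (p.γth * r ^ p.α / p.P) * contrib p s s₀ b (z.2 j, z.1 j)) :=
    measurable_expNeg.comp (Measurable.tsum fun j => Finset.measurable_fun_sum _ fun b _ =>
      ((measurable_contrib s₀ b).comp (((measurable_pi_apply j).comp measurable_snd).prodMk
        ((measurable_pi_apply j).comp measurable_fst))).const_mul _)
  rw [lintegral_congr h1, lintegral_const_mul _ h2, lintegral_prod_symm' _ h2,
    lintegral_expNeg_interference hp A T hr, ← ENNReal.ofReal_mul (Real.exp_pos _).le,
    ← Real.exp_add, coverProb, sub_eq_add_neg]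

lemma measureReal_received [IsProbabilityMeasure μ]
    (hp : p.Admissible s) (m : ℕ) (T : Finset p.Sym) :
    μ.real (A.received m T) = ∫ r in p.distRange s, p.outerIntegrand s T.card r := by
  rw [Measure.real, A.measure_received hp, ENNReal.toReal_ofReal]
  exact setIntegral_nonneg measurableSet_distRange fun r hr =>
    outerIntegrand_nonneg hp _ (pos_of_mem_distRange hp hr)

/-! ### Inclusion-exclusion over the repetitions -/

lemma biInter_θ (m : ℕ) (u : Finset (Fin p.K)) :
    ⋂ k ∈ u, A.θ m k = A.received m (u ×ˢ Finset.univ) := by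
  ext ω
  simp only [Set.mem_iInter, θ, received, Set.mem_ofPred_eq, Finset.mem_product, Finset.mem_univ,
    and_true, Prod.forall]
  exact ⟨fun h k t hk => h k hk t, fun h k hk t => h k t hk⟩

lemma card_symbols (u : Finset (Fin p.K)) :
    (u ×ˢ (Finset.univ : Finset (Fin 4))).card = 4 * u.card := by
  rw [Finset.card_product, Finset.card_univ, Fintype.card_fin, mul_comm]

lemma measureReal_biInter_θ [IsProbabilityMeasure μ]
    (hp : p.Admissible s) (m : ℕ) (u : Finset (Fin p.K)) :
    μ.real (⋂ k ∈ u, A.θ m k) = ∫ r in p.distRange s, p.outerIntegrand s (4 * u.card) r := by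
  rw [biInter_θ, A.measureReal_received hp, card_symbols]

lemma θ_eq (m : ℕ) (k : Fin p.K) : A.θ m k = A.received m ({k} ×ˢ Finset.univ) := by
  rw [← biInter_θ]
  simp

lemma measureReal_success [IsProbabilityMeasure μ]
    (hp : p.Admissible s) (m : ℕ) : μ.real (A.success m) = p.preambleSum s := by
  have h0 : A.success m = ⋃ k ∈ (Finset.univ : Finset (Fin p.K)), A.θ m k := by
    simp [success]
  rw [h0, measureReal_biUnion_eq_sum_powerset
    fun k _ => by rw [θ_eq]; exact A.measurableSet_received m _]
  simp_rw [A.measureReal_biInter_θ hp]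
  -- Each term depends only on the size of the subset, whence the binomial coefficients. The value
  -- `0` at `k = 0` encodes the exclusion of the empty subset.
  have h1 := Finset.sum_powerset_apply_card (x := (Finset.univ : Finset (Fin p.K)))
    (fun k : ℕ => if 1 ≤ k then (-1 : ℝ) ^ (k + 1) *
      ∫ r in p.distRange s, p.outerIntegrand s (4 * k) r else 0)
  rw [Finset.sum_filter]
  simp_rw [← Finset.one_le_card]
  rw [h1, Params.preambleSum, Finset.card_univ, Fintype.card_fin, Finset.range_eq_Ico,
    Finset.sum_eq_sum_Ico_succ_bot (Nat.succ_pos _)]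
  simp only [nonpos_iff_eq_zero, one_ne_zero, if_false, smul_zero, zero_add]
  refine Finset.sum_congr (by ext k; simp [Order.lt_add_one_iff]) fun k hk => ?_
  rw [if_pos (Finset.mem_Icc.1 hk).1, nsmul_eq_mul]
  ring

lemma measureReal_first_θ [IsProbabilityMeasure μ]
    (hp : p.Admissible s) (m : ℕ) {k : ℕ} (hk : k ≤ p.K) :
    μ.real {ω | ∀ i : Fin p.K, (i : ℕ) < k → ω ∈ A.θ m i}
      = ∫ r in p.distRange s, p.outerIntegrand s (4 * k) r := by
  have h : {ω | ∀ i : Fin p.K, (i : ℕ) < k → ω ∈ A.θ m i}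
      = ⋂ i ∈ Finset.univ.filter (fun i : Fin p.K => (i : ℕ) < k), A.θ m i := by
    ext ω
    simp
  rw [h, A.measureReal_biInter_θ hp, Fin.card_filter_val_lt, min_eq_right hk]

lemma success_eq (m : ℕ) : ∃ B, MeasurableSet B ∧ A.success m = A.device m ⁻¹' B := by
  refine ⟨⋃ k : Fin p.K, receivedSet p s s₀ ({k} ×ˢ Finset.univ),
    MeasurableSet.iUnion fun k => measurableSet_receivedSet s₀ _, ?_⟩
  rw [success, Set.preimage_iUnion]
  simp_rw [θ_eq, received_eq]

/-! ### Conditioning on `N` and the RACH success probability -/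

lemma PS_eq [IsProbabilityMeasure μ]
    (hp : p.Admissible s) (m n : ℕ) (hn : μ {ω | A.N ω = n} ≠ 0) :
    A.PS m n = p.preambleSum s := by
  obtain ⟨B, hB, hsB⟩ := A.success_eq m
  have hN : MeasurableSet {ω | A.N ω = n} := A.measurable_N (measurableSet_singleton n)
  have h := (A.indepFun_N_device m).measure_inter_preimage_eq_mul {n} B
    (measurableSet_singleton n) hB
  rw [← A.measureReal_success hp m, PS, Measure.real, Measure.real, cond_apply hN, hsB]
  have h' : μ ({ω | A.N ω = n} ∩ A.device m ⁻¹' B)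
      = μ {ω | A.N ω = n} * μ (A.device m ⁻¹' B) := h
  -- `hn` is essential: conditioning on a null event gives the zero measure.
  rw [h', ← mul_assoc, ENNReal.inv_mul_cancel hn (measure_ne_top _ _), one_mul]

/-- Almost surely `N` takes a value of positive probability, where every factor of the integrand is
known. The integrand multiplies probabilities, not events, so dependence between devices through
common interference plays no role. -/
lemma hasSum_rachSuccess [IsProbabilityMeasure μ]
    (hp : p.Admissible s) :
    HasSum (fun n : ℕ => μ.real {ω | A.N ω = n} * p.preambleSum s * (1 - p.preambleSum s) ^ n)
      A.rachSuccess := by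
  set q := p.preambleSum s with hq
  have hq0 : 0 ≤ q := by
    rw [hq, ← A.measureReal_success hp 0]
    exact measureReal_nonneg
  have hq1 : q ≤ 1 := by
    rw [hq, ← A.measureReal_success hp 0]
    exact measureReal_le_one
  have hae : ∀ᵐ ω ∂μ, ∀ n, A.N ω = n → μ {ω | A.N ω = n} ≠ 0 := by
    rw [ae_all_iff]
    intro n
    by_cases hn : μ {ω | A.N ω = n} = 0
    · have : ∀ᵐ ω ∂μ, ¬ A.N ω = n := by
        rw [ae_iff]
        simpa using hn
      filter_upwards [this] with ω hω h
      exact absurd h hω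
    · exact Filter.Eventually.of_forall fun _ _ => hn
  have hint : A.rachSuccess = ∫ ω, q * (1 - q) ^ A.N ω ∂μ := by
    refine integral_congr_ae ?_
    filter_upwards [hae] with ω hω
    have h1 : ∀ m, A.PS m (A.N ω) = q := fun m => A.PS_eq hp m _ (hω _ rfl)
    simp [h1]
  have hmeas : ∀ n : ℕ, MeasurableSet {ω | A.N ω = n} := fun n =>
    A.measurable_N (measurableSet_singleton n)
  have hUnion : ⋃ n : ℕ, {ω | A.N ω = n} = Set.univ := by
    ext ω
    simp
  have hi : Integrable (fun ω => q * (1 - q) ^ A.N ω) μ := by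
    refine Integrable.of_bound (C := 1) ?_ (Filter.Eventually.of_forall fun ω => ?_)
    · exact ((measurable_of_countable fun n : ℕ => q * (1 - q) ^ n).comp
        A.measurable_N).aestronglyMeasurable
    · have h1 : (1 - q) ^ A.N ω ≤ 1 := pow_le_one₀ (by linarith) (by linarith)
      have h2 : 0 ≤ (1 - q) ^ A.N ω := pow_nonneg (by linarith) _
      rw [Real.norm_of_nonneg (mul_nonneg hq0 h2)]
      exact mul_le_one₀ hq1 h2 h1
  -- Integrating over the partition into level sets of `N` gives convergence and the sum at once.
  have h := hasSum_integral_iUnion (μ := μ) (f := fun ω => q * (1 - q) ^ A.N ω) hmeas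
    (fun i j hij => Set.disjoint_left.2 fun ω hi hj => hij
      ((show A.N ω = i from hi).symm.trans hj)) hi.integrableOn
  rw [hUnion, setIntegral_univ, ← hint] at h
  have hn : ∀ n : ℕ, ∫ ω in {ω | A.N ω = n}, q * (1 - q) ^ A.N ω ∂μ
      = μ.real {ω | A.N ω = n} * q * (1 - q) ^ n := by
    intro n
    rw [setIntegral_congr_fun (g := fun _ => q * (1 - q) ^ n) (hmeas n) fun ω hω => ?_,
      setIntegral_const, smul_eq_mul, mul_assoc]
    rw [show A.N ω = n from hω]
  simpa only [hn] using h

end Model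

end NBIoT

end

theorem theorem2 (p : NBIoT.Params) (s : NBIoT.Scenario) (hp : p.Admissible s) (s₀ : Fin p.S)
    {Ω : Type*} [MeasurableSpace Ω] (μ : Measure Ω) [IsProbabilityMeasure μ]
    (A : NBIoT.Model p s s₀ μ) :
    -- the serving distance has the density `f_R`
    (∀ m : ℕ, μ.map (A.R m) = (volume.restrict (p.distRange s)).withDensity
      (fun r => ENNReal.ofReal (p.fR s r))) ∧
    -- the integrals converge
    (∀ (l : ℕ) (r : ℝ), 0 < r →
      IntegrableOn (p.FIntegrand l r) (Set.Ioi (p.interfererRadius s))) ∧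
    (∀ l : ℕ, IntegrableOn (p.outerIntegrand s l) (p.distRange s)) ∧
    -- the first `k` repetitions, hence `4 * k` symbol groups, are all received
    (∀ (m k : ℕ), 1 ≤ k → k ≤ p.K →
      μ.real {ω | ∀ i : Fin p.K, (i : ℕ) < k → ω ∈ A.θ m i} =
        ∫ r in p.distRange s, p.outerIntegrand s (4 * k) r) ∧
    -- the preamble transmission success probability
    (∀ m : ℕ, μ.real (A.success m) = p.preambleSum s) ∧
    -- the law of the number of intra-group interferers
    (∀ n : ℕ, μ.real {ω | A.N ω = n} = p.pmfN s n) ∧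
    -- the RACH success probability
    HasSum (fun n : ℕ => p.pmfN s n * p.preambleSum s * (1 - p.preambleSum s) ^ n)
      A.rachSuccess := by
  have := A.isProbabilityMeasure_servingLaw
  have hN : ∀ n : ℕ, μ.real {ω | A.N ω = n} = p.pmfN s n := fun n =>
    (A.law_N n).trans (NBIoT.integral_poisson_gammaMeasure (NBIoT.load_nonneg hp) NBIoT.c_pos n)
  refine ⟨fun m => (A.map_R m).trans (NBIoT.servingLaw_eq hp),
    fun l r hr => NBIoT.integrableOn_FIntegrand hp l hr,
    fun l => NBIoT.integrableOn_outerIntegrand hp l,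
    fun m k _ hk => A.measureReal_first_θ hp m hk, A.measureReal_success hp, hN, ?_⟩
  simpa only [hN] using A.hasSum_rachSuccess hp
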